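/- Let $W:\mathbb R\to\mathbb R$ be of class $C^3$ with $W,W',W'',W'''\in L^\infty(\mathbb R)$. For $b>0$ and $k\in\mathbb R$ let $h(k)=-\frac{d^2}{dx^2}+(bx-k)^2+W(x)$ be the self-adjoint operator in $L^2(\mathbb R)$ obtained by closing the operator defined on $C_0^\infty(\mathbb R)$, and let $E_1(k;b,W)<E_2(k;b,W)<\cdots$ be its eigenvalues in increasing order. Primes on $E_j$ denote derivatives with respect to $k$. Fix $j\in\{1,2,\dots\}$, let $\varphi_j$ be the real normalized Hermite function with $-\varphi_j''+x^2\varphi_j=(2j-1)\varphi_j$ and $\|\varphi_j\|_{L^2(\mathbb R)}=1$, and put $$c_3=\|W\|_{L^\infty}\|W''\|_{L^\infty}\Big(\sum_{l=1}^\infty(2|l-j|-1)^{-2}\Big)^{1/2}\Big(\sum_{l\ge1,\ l\ne j}(2|l-j|-\tfrac32)^{-2}+4\Big)^{1/2},$$ $$c_4=\|W'''\|_{L^\infty}\int_{\mathbb R}|y|\,\varphi_j(y)^2\,dy,\qquad c_5=c_3+2\|W'\|_{L^\infty}^2 .$$ (i) For every $b>2\|W\|_{L^\infty}$, the $j$-th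 eigenvalue $E_j(k;b,W)$ exists for every $k\in\mathbb R$, the function $k\mapsto E_j(k;b,W)$ is of class $C^2$ on $\mathbb R$, and $$\big|E_j''(k;b,W)-b^{-2}W''(k/b)\big|\le c_5\,b^{-3}+c_4\,b^{-5/2}\qquad\text{for all }k\in\mathbb R.$$ (ii) Let $x_0\in\mathbb R$. If $W''(x_0)>0$ (resp. $W''(x_0)<0$), then there is $b_1>0$ such that $E_j''(bx_0;b,W)>0$ (resp. $E_j''(bx_0;b,W)<0$) for every $b>b_1$. -/

import Mathlib

open MeasureTheory
open scoped ENNReal ContDiff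

noncomputable section

namespace EdgePotential

/-- The differential expression `-f'' + (b x - k)² f + W f`. -/
def fiberExpr (b : ℝ) (W : ℝ → ℝ) (k : ℝ) (f : ℝ → ℂ) (x : ℝ) : ℂ :=
  -iteratedDeriv 2 f x + (((b * x - k) ^ 2 + W x : ℝ) : ℂ) * f x

/-- The graph in `L²(ℝ) × L²(ℝ)` of `-d²/dx² + (b x - k)² + W` acting on `C_c^∞(ℝ)`. -/
def coreGraph (b : ℝ) (W : ℝ → ℝ) (k : ℝ) :
    Submodule ℂ (Lp ℂ 2 (volume : Measure ℝ) × Lp ℂ 2 (volume : Measure ℝ)) where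
  carrier := {p | ∃ f : ℝ → ℂ, ContDiff ℝ ∞ f ∧ HasCompactSupport f ∧
    p.1 =ᵐ[volume] f ∧ p.2 =ᵐ[volume] fiberExpr b W k f}
  zero_mem' := by
    refine ⟨fun _ => 0, contDiff_const, HasCompactSupport.zero, Lp.coeFn_zero _ _ _, ?_⟩
    filter_upwards [Lp.coeFn_zero ℂ 2 (volume : Measure ℝ)] with x hx
    simp only [Prod.snd_zero, hx, fiberExpr]
    simp
  add_mem' := by
    rintro p q ⟨f, hf, hfc, h1, h2⟩ ⟨g, hg, hgc, h3, h4⟩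
    refine ⟨f + g, hf.add hg, hfc.add hgc, ?_, ?_⟩
    · filter_upwards [Lp.coeFn_add p.1 q.1, h1, h3] with x hx hx1 hx3
      simp only [Prod.fst_add, hx, Pi.add_apply, hx1, hx3]
    · filter_upwards [Lp.coeFn_add p.2 q.2, h2, h4] with x hx hx2 hx4
      have h : iteratedDeriv 2 (f + g) x = iteratedDeriv 2 f x + iteratedDeriv 2 g x :=
        iteratedDeriv_add (contDiff_infty.1 hf 2).contDiffAt
          (contDiff_infty.1 hg 2).contDiffAt
      simp only [Prod.snd_add, hx, Pi.add_apply, hx2, hx4, fiberExpr, h]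
      ring
  smul_mem' := by
    rintro c p ⟨f, hf, hfc, h1, h2⟩
    refine ⟨c • f, contDiff_const.smul hf, hfc.smul_left (f := fun _ => c), ?_, ?_⟩
    · filter_upwards [Lp.coeFn_smul c p.1, h1] with x hx hx1
      simp [hx, hx1]
    · filter_upwards [Lp.coeFn_smul c p.2, h2] with x hx hx2
      have h : iteratedDeriv 2 (c • f) x = c • iteratedDeriv 2 f x :=
        iteratedDeriv_const_smul (contDiff_infty.1 hf 2).contDiffAt c
      simp only [Prod.smul_snd, hx, Pi.smul_apply, hx2, fiberExpr, h, smul_eq_mul]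
      ring

/-- The graph of the self-adjoint operator `h(k) = -d²/dx² + (b x - k)² + W(x)` in `L²(ℝ)`,
that is, of the closure of the operator on `C_c^∞(ℝ)`. -/
def fiberGraph (b : ℝ) (W : ℝ → ℝ) (k : ℝ) :
    Submodule ℂ (Lp ℂ 2 (volume : Measure ℝ) × Lp ℂ 2 (volume : Measure ℝ)) :=
  (coreGraph b W k).topologicalClosure

/-- The set of the eigenvalues of `h(k)`: `h(k) u = μ u` for some nonzero `u` in the domain. -/
def eigenvalues (b : ℝ) (W : ℝ → ℝ) (k : ℝ) : Set ℝ :=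
  {μ | ∃ u : Lp ℂ 2 (volume : Measure ℝ), u ≠ 0 ∧ (u, (μ : ℂ) • u) ∈ fiberGraph b W k}

/-- `μ` is the `j`-th eigenvalue (`j = 1, 2, …`) of `h(k)` in increasing order. -/
def IsNthEigenvalue (j : ℕ) (b : ℝ) (W : ℝ → ℝ) (k μ : ℝ) : Prop :=
  μ ∈ eigenvalues b W k ∧ {ν ∈ eigenvalues b W k | ν < μ}.encard + 1 = j

/-- The band function `E_j(k; b, W)`. There is at most one `μ` with
`IsNthEigenvalue j b W k μ`, so that the infimum is over at most one number. -/
def bandE (j : ℕ) (b : ℝ) (W : ℝ → ℝ) (k : ℝ) : ℝ :=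
  sInf {μ | IsNthEigenvalue j b W k μ}

/-- The norm of `L^∞(ℝ)`. -/
def linftyNorm (f : ℝ → ℝ) : ℝ := (eLpNorm f ∞ (volume : Measure ℝ)).toReal

/-- The normalized Hermite function: `-φ'' + x² φ = (2 j - 1) φ` and `‖φ‖ = 1` in `L²(ℝ)`, for
`j = 1, 2, …`. Mathlib's Hermite polynomials are orthogonal for the weight `exp (-x² / 2)`, whence
the factor `√2`. -/
def hermiteFun (j : ℕ) (x : ℝ) : ℝ :=
  Polynomial.aeval (√2 * x) (Polynomial.hermite (j - 1)) * Real.exp (-x ^ 2 / 2) /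
    √(√Real.pi * (j - 1).factorial)

def c₃ (W : ℝ → ℝ) (j : ℕ) : ℝ :=
  linftyNorm W * linftyNorm (iteratedDeriv 2 W) *
    √(∑' l : ℕ+, ((2 * |(l : ℝ) - j| - 1) ^ 2)⁻¹) *
    √(∑' l : {l : ℕ+ // (l : ℕ) ≠ j}, ((2 * |((l : ℕ+) : ℝ) - j| - 3 / 2) ^ 2)⁻¹ + 4)

def c₄ (W : ℝ → ℝ) (j : ℕ) : ℝ :=
  linftyNorm (iteratedDeriv 3 W) * ∫ y : ℝ, |y| * hermiteFun j y ^ 2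

def c₅ (W : ℝ → ℝ) (j : ℕ) : ℝ := c₃ W j + 2 * linftyNorm (iteratedDeriv 1 W) ^ 2

end EdgePotential

end

/-! Translation by `k / b` turns `h(k)` into `-d²/dx² + b²x² + W(x + k/b)`. Hence `E_j(k) = (2j - 1)
b + F(k/b)`, where `F(t)` is the shift of the oscillator level `(2j - 1) b` caused by the bounded
operator `B(t)` of multiplication by `W(· + t)`. Then `E_j'' = b⁻² F''(k/b)`, and it remains to
compare `F''` with `W''`.

The shift is found by Lyapunov–Schmidt reduction. Let `e` be the unit eigenvector at the level and
`R` the reduced resolvent there, with `‖R‖ ≤ 1/(2b)` because the levels are `2b` apart. A vector `u`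
with `⟪e, u⟫ = 1` is an eigenvector at the shift `ε` exactly when `u + R (B - ε) u = e` and `⟪e, (B
- ε) u⟫ = 0`. For `|ε| ≤ ‖W‖` and `2‖W‖ < b` a Neumann series solves the first equation, and the
second then has exactly one root in `[-‖W‖, ‖W‖]` (`exists_shift`, `shift_unique`). Every eigenvalue
lies within `‖W‖` of a level (`exists_abs_sub_le`), so the roots at the successive levels list the
spectrum in increasing order (`nth_of_clusters`).

The identity `inner_sub_apply` compares two parameters exactly and gives `F' = ⟪u, B'u⟫ / ‖u‖²`. A
further differentiation gives `F'' = (⟪u, B''u⟫ + 2 Re ⟪u', (B' - F')u⟫) / ‖u‖²`. The first term is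
within `2‖W‖‖W''‖/b` of `⟪e, B''e⟫`, the second is at most `2‖W'‖²/b` (`abs_eigSlopeDeriv_sub_le`),
and `⟪e, B''e⟫` averages `W''(· + t)` over a density of width `b^(-1/2)`, hence is within `c₄
b^(-1/2)` of `W''(t)`. Since `2‖W‖‖W''‖ ≤ c₃`, this is (i). In (ii) the error is `o(b⁻²)`.

That the closure from `C_c^∞` is the diagonal operator in the Hermite basis plus `W` is
`mem_fiberGraph_iff`; it rests on the completeness of the Hermite functions (`oscBasis`) and a
cutoff argument (`oscVec_mem_fiberGraph`). -/

noncomputable section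

namespace EdgePotential

open scoped InnerProductSpace Topology
open Filter

/-! ### The corrector equation in a Hilbert space -/

variable {H : Type*} [NormedAddCommGroup H] [InnerProductSpace ℂ H]

/-- `R` is symmetric with `R e = 0`, `‖e‖ = 1` and `‖R‖ ≤ 1 / (2 b)`, like the reduced resolvent of
an operator at an isolated simple eigenvalue with unit eigenvector `e` and isolation distance
`2 b`. -/
structure IsReducedResolvent (R : H →L[ℂ] H) (e : H) (b : ℝ) : Prop where
  pos : 0 < b
  symm : ∀ x y, ⟪R x, y⟫_ℂ = ⟪x, R y⟫_ℂ
  apply_self : R e = 0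
  norm_eq : ‖e‖ = 1
  bound : ∀ x, 2 * b * ‖R x‖ ≤ ‖x‖

/-- A symmetric bounded operator of norm at most `w`. -/
structure IsSymmBdd (B : H →L[ℂ] H) (w : ℝ) : Prop where
  symm : ∀ x y, ⟪B x, y⟫_ℂ = ⟪x, B y⟫_ℂ
  bound : ∀ x, ‖B x‖ ≤ w * ‖x‖

/-- The operator `B - ε`. -/
def shift (B : H →L[ℂ] H) (ε : ℝ) : H →L[ℂ] H := B - ε • (1 : H →L[ℂ] H)

@[simp] lemma shift_apply (B : H →L[ℂ] H) (ε : ℝ) (x : H) : shift B ε x = B x - ε • x := by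
  simp [shift]

lemma IsSymmBdd.shift {B : H →L[ℂ] H} {w : ℝ} (hB : IsSymmBdd B w) {ε : ℝ} (hε : |ε| ≤ w) :
    IsSymmBdd (shift B ε) (2 * w) where
  symm x y := by
    rw [shift_apply, shift_apply, inner_sub_left, inner_sub_right, hB.symm,
      inner_smul_left_eq_smul, inner_smul_right_eq_smul]
  bound x := by
    rw [shift_apply]
    calc ‖B x - ε • x‖ ≤ ‖B x‖ + ‖ε • x‖ := norm_sub_le _ _
      _ ≤ w * ‖x‖ + w * ‖x‖ := by
        gcongr
        · exact hB.bound x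
        · rw [norm_smul]; gcongr; exact hε
      _ = 2 * w * ‖x‖ := by ring

section Equation

variable {R : H →L[ℂ] H} {e : H} {b w : ℝ}

/-- The range of `R` is orthogonal to `e`, because `R` is symmetric and kills `e`. -/
lemma inner_eq_one (hR : IsReducedResolvent R e b) {y u : H} (hu : u + R y = e) :
    ⟪e, u⟫_ℂ = 1 := by
  have h : ⟪e, u + R y⟫_ℂ = 1 := by
    rw [hu, inner_self_eq_norm_sq_to_K, hR.norm_eq]; simp
  rwa [inner_add_right, ← hR.symm, hR.apply_self, inner_zero_left, add_zero] at h

lemma norm_sq_eq (hR : IsReducedResolvent R e b) {y u : H} (hu : u + R y = e) :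
    ‖u‖ ^ 2 = 1 + ‖u - e‖ ^ 2 := by
  have h : ⟪e, u - e⟫_ℂ = 0 := by
    rw [inner_sub_right, inner_eq_one hR hu, inner_self_eq_norm_sq_to_K, hR.norm_eq]; simp
  have h2 := norm_add_sq_eq_norm_sq_add_norm_sq_of_inner_eq_zero e (u - e) h
  rw [add_sub_cancel, hR.norm_eq] at h2
  linarith [h2]

lemma norm_sub_le_mul (hR : IsReducedResolvent R e b) {A : H →L[ℂ] H}
    (hA : IsSymmBdd A (2 * w)) {u : H} (hu : u + R (A u) = e) : b * ‖u - e‖ ≤ w * ‖u‖ := by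
  have h : u - e = -R (A u) := by rw [← hu]; abel
  rw [h, norm_neg]
  linarith [hR.bound (A u), hA.bound u]

/-- With `d = ‖u - e‖`, the gap condition gives `2d ≤ ‖u‖`, and Pythagoras gives `4d² ≤ 1 + d²`. -/
lemma norm_sub_sq_le (hR : IsReducedResolvent R e b) (hwb : 2 * w < b) {A : H →L[ℂ] H}
    (hA : IsSymmBdd A (2 * w)) {u : H} (hu : u + R (A u) = e) : ‖u - e‖ ^ 2 ≤ 1 / 3 := by
  have h1 := norm_sub_le_mul hR hA hu
  have h2 := norm_sq_eq hR hu
  have h3 : 2 * ‖u - e‖ ≤ ‖u‖ := by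
    have := hR.pos
    have h4 : b * (2 * ‖u - e‖) ≤ b * ‖u‖ := by nlinarith [norm_nonneg u]
    exact le_of_mul_le_mul_left h4 this
  nlinarith [norm_nonneg (u - e)]

lemma norm_le_two (hR : IsReducedResolvent R e b) (hwb : 2 * w < b) {A : H →L[ℂ] H}
    (hA : IsSymmBdd A (2 * w)) {u : H} (hu : u + R (A u) = e) : ‖u‖ ≤ 2 := by
  have h1 := norm_sub_sq_le hR hwb hA hu
  have h2 := norm_sq_eq hR hu
  nlinarith [norm_nonneg u]

/-- Both deviations `uᵢ - e` are orthogonal to `e`, so `⟪u₂, u₁⟫ - 1` is their inner product, of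
size at most `1/3`. The lower bound allows division by `⟪u₂, u₁⟫` in the uniqueness and
differentiability arguments. -/
lemma two_thirds_le_re_inner (hR : IsReducedResolvent R e b) (hwb : 2 * w < b)
    {A₁ A₂ : H →L[ℂ] H} (hA₁ : IsSymmBdd A₁ (2 * w)) (hA₂ : IsSymmBdd A₂ (2 * w)) {u₁ u₂ : H}
    (hu₁ : u₁ + R (A₁ u₁) = e) (hu₂ : u₂ + R (A₂ u₂) = e) : 2 / 3 ≤ (⟪u₂, u₁⟫_ℂ).re := by
  have h : ⟪u₂ - e, u₁ - e⟫_ℂ = ⟪u₂, u₁⟫_ℂ - 1 := by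
    have h1 : ⟪u₂, e⟫_ℂ = 1 := by rw [← inner_conj_symm, inner_eq_one hR hu₂]; simp
    have h2 : ⟪e, e⟫_ℂ = 1 := by rw [inner_self_eq_norm_sq_to_K, hR.norm_eq]; simp
    rw [inner_sub_left, inner_sub_right, inner_sub_right, inner_eq_one hR hu₁, h1, h2]; ring
  have h3 : |(⟪u₂ - e, u₁ - e⟫_ℂ).re| ≤ ‖u₂ - e‖ * ‖u₁ - e‖ :=
    (Complex.abs_re_le_norm _).trans (norm_inner_le_norm _ _)
  rw [h, Complex.sub_re, Complex.one_re] at h3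
  have h4 := norm_sub_sq_le hR hwb hA₁ hu₁
  have h5 := norm_sub_sq_le hR hwb hA₂ hu₂
  nlinarith [(abs_le.1 h3).1, sq_nonneg (‖u₂ - e‖ - ‖u₁ - e‖)]

/-- Each equation is substituted for `e`; the terms with `R` coincide by symmetry and cancel. The
identity is exact for two different perturbations, so it serves for uniqueness, continuity and
differentiability of the shift. -/
lemma inner_sub_apply (hR : IsReducedResolvent R e b) {A₁ A₂ : H →L[ℂ] H}
    (hA₂ : IsSymmBdd A₂ w) {u₁ u₂ : H}
    (hu₁ : u₁ + R (A₁ u₁) = e) (hu₂ : u₂ + R (A₂ u₂) = e) :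
    ⟪u₂, (A₁ - A₂) u₁⟫_ℂ = ⟪e, A₁ u₁⟫_ℂ - ⟪A₂ u₂, e⟫_ℂ := by
  conv_rhs => rw [← hu₂]; lhs; rw [hu₂]
  have h1 : ⟪e, A₁ u₁⟫_ℂ = ⟪u₂, A₁ u₁⟫_ℂ + ⟪A₂ u₂, R (A₁ u₁)⟫_ℂ := by
    rw [← hR.symm, ← inner_add_left, hu₂]
  have h2 : ⟪A₂ u₂, e⟫_ℂ = ⟪u₂, A₂ u₁⟫_ℂ + ⟪A₂ u₂, R (A₁ u₁)⟫_ℂ := by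
    rw [← hA₂.symm, ← inner_add_right, hu₁]
  rw [hu₂, h1, h2, sub_apply, inner_sub_right]; ring

lemma inner_apply_im (hR : IsReducedResolvent R e b) {A : H →L[ℂ] H}
    (hA : IsSymmBdd A w) {u : H} (hu : u + R (A u) = e) : (⟪e, A u⟫_ℂ).im = 0 := by
  have h := congrArg Complex.im (inner_sub_apply hR hA hu hu)
  rw [← inner_conj_symm (A u) e, sub_self] at h
  simp only [zero_apply, inner_zero_right, Complex.zero_im, Complex.sub_im,
    Complex.conj_im] at h
  linarith

lemma inner_apply_re (hR : IsReducedResolvent R e b) {A : H →L[ℂ] H} {u : H}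
    (hu : u + R (A u) = e) :
    |(⟪e, A u⟫_ℂ).re - (⟪u, A u⟫_ℂ).re| ≤ ‖A u‖ ^ 2 / (2 * b) := by
  have h1 : ⟪e, A u⟫_ℂ = ⟪u, A u⟫_ℂ + ⟪R (A u), A u⟫_ℂ := by rw [← inner_add_left, hu]
  rw [h1, Complex.add_re, add_sub_cancel_left]
  refine ((Complex.abs_re_le_norm _).trans (norm_inner_le_norm _ _)).trans ?_
  have hb := hR.pos
  rw [le_div_iff₀ (by positivity)]
  nlinarith [hR.bound (A u), norm_nonneg (A u)]

end Equation

/-! ### Solving for the corrector and the shift -/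

section Solve

variable {R : H →L[ℂ] H} {e : H} {b w : ℝ}

/-- The solution `u` of `u + R (A u) = e`. -/
def corrector (R : H →L[ℂ] H) (e : H) (A : H →L[ℂ] H) : H := Ring.inverse (1 + R * A) e

lemma norm_le_of_add_eq (hR : IsReducedResolvent R e b) (hwb : 2 * w < b)
    {A : H →L[ℂ] H} (hA : IsSymmBdd A (2 * w)) {x y : H} (h : x + R (A x) = R y) :
    b * ‖x‖ ≤ ‖y‖ := by
  have h1 := hR.bound y
  have h2 := hR.bound (A x)
  have h3 := hA.bound x
  have h4 : ‖x‖ ≤ ‖R y‖ + ‖R (A x)‖ := by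
    calc ‖x‖ = ‖R y - R (A x)‖ := by rw [← h, add_sub_cancel_right]
      _ ≤ _ := norm_sub_le _ _
  have hb := hR.pos
  nlinarith [norm_nonneg x]

/-- For two roots the right side of `inner_sub_apply` vanishes, which leaves `(ε₂ - ε₁) ⟪u₂, u₁⟫ =
0`. -/
lemma shift_unique (hR : IsReducedResolvent R e b) (hwb : 2 * w < b)
    {B : H →L[ℂ] H} (hB : IsSymmBdd B w) {ε₁ ε₂ : ℝ} (h₁ : |ε₁| ≤ w) (h₂ : |ε₂| ≤ w) {u₁ u₂ : H}
    (hu₁ : u₁ + R (shift B ε₁ u₁) = e) (hu₂ : u₂ + R (shift B ε₂ u₂) = e)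
    (hg₁ : ⟪e, shift B ε₁ u₁⟫_ℂ = 0) (hg₂ : ⟪e, shift B ε₂ u₂⟫_ℂ = 0) : ε₁ = ε₂ := by
  have h := inner_sub_apply hR (hB.shift h₂) hu₁ hu₂
  rw [hg₁, ← inner_conj_symm _ e, hg₂, sub_apply, shift_apply, shift_apply] at h
  have h3 : B u₁ - ε₁ • u₁ - (B u₁ - ε₂ • u₁) = (ε₂ - ε₁) • u₁ := by rw [sub_smul]; abel
  rw [h3, inner_smul_right_eq_smul, map_zero, sub_zero] at h
  have h4 := two_thirds_le_re_inner hR hwb (hB.shift h₁) (hB.shift h₂) hu₁ hu₂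
  rcases smul_eq_zero.1 h with h | h
  · linarith
  · rw [h, Complex.zero_re] at h4; norm_num at h4

variable [CompleteSpace H]

lemma isUnit_one_add (hR : IsReducedResolvent R e b) (hwb : 2 * w < b)
    {A : H →L[ℂ] H} (hA : IsSymmBdd A (2 * w)) : IsUnit (1 + R * A) := by
  have h : ‖R * A‖ ≤ 1 / 2 := by
    refine ContinuousLinearMap.opNorm_le_bound _ (by norm_num) fun x => ?_
    have hb := hR.pos
    have h1 := hR.bound (A x)
    have h2 := hA.bound x
    have h4 : b * (2 * ‖R (A x)‖) ≤ b * ‖x‖ := by nlinarith [norm_nonneg x]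
    have := le_of_mul_le_mul_left h4 hb
    change ‖R (A x)‖ ≤ _
    linarith
  have h2 : ‖-(R * A)‖ < 1 := by rw [norm_neg]; linarith
  simpa using isUnit_one_sub_of_norm_lt_one h2

lemma corrector_spec (hR : IsReducedResolvent R e b) (hwb : 2 * w < b)
    {A : H →L[ℂ] H} (hA : IsSymmBdd A (2 * w)) :
    corrector R e A + R (A (corrector R e A)) = e := by
  have h := Ring.mul_inverse_cancel _ (isUnit_one_add hR hwb hA)
  exact congrArg (fun T : H →L[ℂ] H => T e) h

lemma hasDerivAt_corrector (hR : IsReducedResolvent R e b) (hwb : 2 * w < b)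
    {A : ℝ → H →L[ℂ] H} (hA : ∀ t, IsSymmBdd (A t) (2 * w)) {A' : H →L[ℂ] H} {t : ℝ}
    (hA' : HasDerivAt A A' t) :
    HasDerivAt (fun s => corrector R e (A s))
      (-(Ring.inverse (1 + R * A t) (R (A' (corrector R e (A t)))))) t := by
  obtain ⟨x, hx⟩ := isUnit_one_add hR hwb (hA t)
  have h1 : HasDerivAt (fun s => 1 + R * A s) (R * A') t := (hA'.const_mul R).const_add 1
  have h2 := hasFDerivAt_ringInverse (𝕜 := ℝ) x
  rw [hx] at h2
  have h3 := h2.comp_hasDerivAt t h1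
  have h4 := (((ContinuousLinearMap.apply ℂ H e).restrictScalars ℝ).hasFDerivAt).comp_hasDerivAt
    t h3
  have h5 : (↑x⁻¹ : H →L[ℂ] H) = Ring.inverse (1 + R * A t) := by
    rw [← hx, Ring.inverse_unit]
  rw [h5] at h4
  exact h4

lemma continuous_inverse_one_add (hR : IsReducedResolvent R e b) (hwb : 2 * w < b)
    {X : Type*} [TopologicalSpace X]
    {A : X → H →L[ℂ] H} (hA : ∀ t, IsSymmBdd (A t) (2 * w)) (hc : Continuous A) :
    Continuous (fun s => Ring.inverse (1 + R * A s)) := by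
  rw [continuous_iff_continuousAt]
  intro t
  obtain ⟨x, hx⟩ := isUnit_one_add hR hwb (hA t)
  have := NormedRing.inverse_continuousAt x
  rw [hx] at this
  exact ContinuousAt.comp (f := fun s => 1 + R * A s) this (by fun_prop)

/-- The scalar equation for the shift of the eigenvalue has a solution in `[-w, w]`. -/
lemma exists_shift (hR : IsReducedResolvent R e b) (hwb : 2 * w < b) (hw : 0 ≤ w)
    {B : H →L[ℂ] H} (hB : IsSymmBdd B w) :
    ∃ ε : ℝ, |ε| ≤ w ∧ ⟪e, shift B ε (corrector R e (shift B ε))⟫_ℂ = 0 := by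
  -- Clamping to `[-w, w]` keeps the bound `2w`, and so the invertibility of `1 + R A`, for every
  -- real `ε`; thus `g` is continuous on all of `ℝ`.
  let p : ℝ → ℝ := fun ε => max (-w) (min w ε)
  have hp : ∀ ε, |p ε| ≤ w := fun ε =>
    abs_le.2 ⟨le_max_left _ _, max_le (by linarith) (min_le_left _ _)⟩
  let A : ℝ → H →L[ℂ] H := fun ε => shift B (p ε)
  have hA : ∀ ε, IsSymmBdd (A ε) (2 * w) := fun ε => hB.shift (hp ε)
  have hpc : Continuous p := by fun_prop
  have hAc : Continuous A := by simp only [A, shift]; fun_prop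
  let g : ℝ → ℝ := fun ε => (⟪e, A ε (corrector R e (A ε))⟫_ℂ).re
  have hg : Continuous g := by
    have h1 : Continuous fun ε => corrector R e (A ε) :=
      (continuous_inverse_one_add hR hwb hA hAc).clm_apply continuous_const
    exact Complex.continuous_re.comp (continuous_const.inner (hAc.clm_apply h1))
  have hb := hR.pos
  have key : ∀ ε, ∀ u : H, ‖shift B ε u‖ ^ 2 =
      ‖B u‖ ^ 2 - 2 * ε * (⟪u, B u⟫_ℂ).re + ε ^ 2 * ‖u‖ ^ 2 := by
    intro ε u
    rw [shift_apply, norm_sub_sq (𝕜 := ℂ), norm_smul, inner_smul_right_eq_smul,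
      hB.symm]
    simp only [Complex.real_smul, RCLike.re_to_complex, Complex.re_ofReal_mul, Real.norm_eq_abs,
      mul_pow, sq_abs]
    ring
  have key2 : ∀ ε, ∀ u : H, (⟪u, shift B ε u⟫_ℂ).re = (⟪u, B u⟫_ℂ).re - ε * ‖u‖ ^ 2 := by
    intro ε u
    have h0 : ⟪u, u⟫_ℂ = ((‖u‖ ^ 2 : ℝ) : ℂ) := by
      rw [inner_self_eq_norm_sq_to_K]; norm_cast
    rw [shift_apply, inner_sub_right, inner_smul_right_eq_smul, h0]
    simp only [Complex.real_smul, Complex.sub_re, Complex.re_ofReal_mul, Complex.ofReal_re]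
  have key3 : ∀ u : H, ‖B u‖ ^ 2 ≤ w ^ 2 * ‖u‖ ^ 2 := fun u => by
    rw [← mul_pow]; exact pow_le_pow_left₀ (norm_nonneg _) (hB.bound u) 2
  have key4 : ∀ u : H, |(⟪u, B u⟫_ℂ).re| ≤ w * ‖u‖ ^ 2 := fun u => by
    refine ((Complex.abs_re_le_norm _).trans (norm_inner_le_norm _ _)).trans ?_
    nlinarith [hB.bound u, norm_nonneg u]
  have hdiv : ∀ X c : ℝ, 0 ≤ c → X ≤ 2 * w * c → X / (2 * b) ≤ c := by
    intro X c hc h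
    rw [div_le_iff₀ (by positivity)]; nlinarith
  -- At `ε = -w` the operator `A = B + w` is nonnegative and `‖A u‖² ≤ 2w ⟪u, A u⟫`. The error `‖A
  -- u‖² / (2b)` of `inner_apply_re` is then at most `⟪u, A u⟫`, so `g (-w)` is nonnegative. At `ε =
  -- w` all signs are reversed.
  have hlo : 0 ≤ g (-w) := by
    have h1 := (abs_le.1 (inner_apply_re hR (corrector_spec hR hwb (hA (-w))))).1
    have hpw : A (-w) = shift B (-w) := by simp only [A, p]; congr 1; simp [hw]
    change 0 ≤ (⟪e, A (-w) (corrector R e (A (-w)))⟫_ℂ).re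
    set u := corrector R e (A (-w))
    rw [hpw] at h1 ⊢
    have h2 := hdiv (‖shift B (-w) u‖ ^ 2) (⟪u, shift B (-w) u⟫_ℂ).re
      (by rw [key2]; linarith [(abs_le.1 (key4 u)).1])
      (by rw [key2, key]; linarith [key3 u])
    linarith
  have hhi : g w ≤ 0 := by
    have h1 := (abs_le.1 (inner_apply_re hR (corrector_spec hR hwb (hA w)))).2
    have hpw : A w = shift B w := by simp only [A, p]; congr 1; simp [hw]
    change (⟪e, A w (corrector R e (A w))⟫_ℂ).re ≤ 0
    set u := corrector R e (A w)
    rw [hpw] at h1 ⊢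
    have h2 := hdiv (‖shift B w u‖ ^ 2) (-(⟪u, shift B w u⟫_ℂ).re)
      (by rw [key2]; linarith [(abs_le.1 (key4 u)).2])
      (by rw [key2, key]; linarith [key3 u])
    linarith
  obtain ⟨ε, -, hε⟩ := intermediate_value_Icc' (by linarith : -w ≤ w) hg.continuousOn ⟨hhi, hlo⟩
  exact ⟨p ε, hp ε, Complex.ext hε (inner_apply_im hR (hA ε) (corrector_spec hR hwb (hA ε)))⟩

end Solve

end EdgePotential

namespace EdgePotential

open scoped InnerProductSpace Topology
open Filter

/-! ### Second-order perturbation theory for a family of operators -/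

section Family

variable {H : Type*} [NormedAddCommGroup H] [InnerProductSpace ℂ H]
  {R : H →L[ℂ] H} {e : H} {b w : ℝ}

/-- For `ψ = u / ‖u‖` the difference is `Re ⟪ψ - e, C (ψ + e)⟫`, and `‖ψ - e‖ ‖ψ + e‖ = 2 ‖u - e‖ /
‖u‖ ≤ 2w / b`. -/
lemma abs_re_inner_sub_le (hR : IsReducedResolvent R e b) {A C : H →L[ℂ] H} {w₂ : ℝ}
    (hA : IsSymmBdd A (2 * w)) (hC : IsSymmBdd C w₂) (hw₂ : 0 ≤ w₂) {u : H}
    (hu : u + R (A u) = e) :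
    |(⟪u, C u⟫_ℂ).re / ‖u‖ ^ 2 - (⟪e, C e⟫_ℂ).re| ≤ 2 * w * w₂ / b := by
  have hb := hR.pos
  have hn := norm_sq_eq hR hu
  have hup : 0 < ‖u‖ := by
    have : 0 < ‖u‖ ^ 2 := by rw [hn]; positivity
    exact (sq_pos_iff.1 this).lt_of_le' (norm_nonneg _)
  have hle := norm_sub_le_mul hR hA hu
  set n := ‖u‖ with hn'
  set ψ : H := n⁻¹ • u with hψ
  have hψn : ‖ψ‖ = 1 := by
    rw [hψ, norm_smul, Real.norm_of_nonneg (by positivity), ← hn', inv_mul_cancel₀ hup.ne']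
  have hψe : (⟪ψ, e⟫_ℂ).re = n⁻¹ := by
    rw [hψ, inner_smul_left_eq_smul, ← inner_conj_symm, inner_eq_one hR hu]
    simp
  have h1 : (⟪u, C u⟫_ℂ).re / n ^ 2 = (⟪ψ, C ψ⟫_ℂ).re := by
    rw [hψ, ContinuousLinearMap.map_smul_of_tower, inner_smul_left_eq_smul,
      inner_smul_right_eq_smul]
    simp only [Complex.real_smul, Complex.re_ofReal_mul]
    field_simp
  have h2 : (⟪ψ, C ψ⟫_ℂ).re - (⟪e, C e⟫_ℂ).re = (⟪ψ - e, C (ψ + e)⟫_ℂ).re := by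
    have h3 : (⟪ψ, C e⟫_ℂ).re = (⟪e, C ψ⟫_ℂ).re := by
      rw [← hC.symm, ← inner_conj_symm, Complex.conj_re]
    rw [map_add, inner_sub_left, inner_add_right, inner_add_right]
    simp only [Complex.sub_re, Complex.add_re, h3]
    ring
  rw [h1, h2]
  have h4 : ‖ψ - e‖ ^ 2 = 2 - 2 * n⁻¹ := by
    rw [norm_sub_sq (𝕜 := ℂ), hψn, hR.norm_eq, RCLike.re_to_complex, hψe]; ring
  have h5 : ‖ψ + e‖ ^ 2 = 2 + 2 * n⁻¹ := by
    rw [norm_add_sq (𝕜 := ℂ), hψn, hR.norm_eq, RCLike.re_to_complex, hψe]; ring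
  have h6 : ‖ψ - e‖ * ‖ψ + e‖ ≤ 2 * w / b := by
    have hw : 0 ≤ 2 * w / b := by
      have : 0 ≤ w * n := le_trans (by positivity) hle
      have := nonneg_of_mul_nonneg_left this hup
      positivity
    refine le_of_sq_le_sq ?_ hw
    have h7 : n ^ 2 * (2 * w / b) ^ 2 ≥ 4 * (n ^ 2 - 1) := by
      have h8 : (b * ‖u - e‖) ^ 2 ≤ (w * n) ^ 2 := pow_le_pow_left₀ (by positivity) hle 2
      have h9 : n ^ 2 * (2 * w / b) ^ 2 = 4 * ((w * n) ^ 2 / b ^ 2) := by field_simp; ring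
      rw [h9, hn, add_sub_cancel_left]
      have : ‖u - e‖ ^ 2 ≤ (w * n) ^ 2 / b ^ 2 := by
        rw [le_div_iff₀ (by positivity)]; linarith [h8, mul_pow b ‖u - e‖ 2]
      linarith
    have h10 : (‖ψ - e‖ * ‖ψ + e‖) ^ 2 = 4 * (n ^ 2 - 1) / n ^ 2 := by
      rw [mul_pow, h4, h5]; field_simp; ring
    rw [h10, div_le_iff₀ (by positivity)]
    linarith
  calc _ ≤ ‖ψ - e‖ * (w₂ * ‖ψ + e‖) :=
        ((Complex.abs_re_le_norm _).trans (norm_inner_le_norm _ _)).trans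
          (by gcongr; exact hC.bound _)
    _ = (‖ψ - e‖ * ‖ψ + e‖) * w₂ := by ring
    _ ≤ 2 * w / b * w₂ := by gcongr
    _ = _ := by ring

/-- The data of a `C²` family of symmetric bounded perturbations, with the shift `ε` of the
eigenvalue. -/
structure IsPerturbedFamily (R : H →L[ℂ] H) (e : H) (b w w₁ w₂ : ℝ) (B B' B'' : ℝ → H →L[ℂ] H)
    (ε : ℝ → ℝ) : Prop where
  reduced : IsReducedResolvent R e b
  gap : 2 * w < b
  symm : ∀ t, IsSymmBdd (B t) w
  symm' : ∀ t, IsSymmBdd (B' t) w₁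
  symm'' : ∀ t, IsSymmBdd (B'' t) w₂
  hasDeriv : ∀ t, HasDerivAt B (B' t) t
  hasDeriv' : ∀ t, HasDerivAt B' (B'' t) t
  cont'' : Continuous B''
  abs_le : ∀ t, |ε t| ≤ w
  inner_eq : ∀ t, ⟪e, shift (B t) (ε t) (corrector R e (shift (B t) (ε t)))⟫_ℂ = 0

variable {w₁ w₂ : ℝ} {B B' B'' : ℝ → H →L[ℂ] H} {ε : ℝ → ℝ}

namespace IsPerturbedFamily

lemma bddShift (h : IsPerturbedFamily R e b w w₁ w₂ B B' B'' ε) (t : ℝ) :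
    IsSymmBdd (shift (B t) (ε t)) (2 * w) := (h.symm t).shift (h.abs_le t)

lemma continuous_family (h : IsPerturbedFamily R e b w w₁ w₂ B B' B'' ε) : Continuous B :=
  continuous_iff_continuousAt.2 fun t => (h.hasDeriv t).continuousAt

lemma continuous_family' (h : IsPerturbedFamily R e b w w₁ w₂ B B' B'' ε) : Continuous B' :=
  continuous_iff_continuousAt.2 fun t => (h.hasDeriv' t).continuousAt

variable [CompleteSpace H]

lemma spec (h : IsPerturbedFamily R e b w w₁ w₂ B B' B'' ε) (t : ℝ) :
    corrector R e (shift (B t) (ε t)) +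
      R (shift (B t) (ε t) (corrector R e (shift (B t) (ε t)))) = e :=
  corrector_spec h.reduced h.gap (h.bddShift t)

/-- Division by `s - t` turns this into a difference quotient of `ε`, so the Feynman–Hellmann
formula follows from continuity of the corrector alone. -/
lemma cross (h : IsPerturbedFamily R e b w w₁ w₂ B B' B'' ε) (s t : ℝ) :
    (ε s - ε t) * (⟪corrector R e (shift (B t) (ε t)), corrector R e (shift (B s) (ε s))⟫_ℂ).re =
    (⟪corrector R e (shift (B t) (ε t)),
      (B s - B t) (corrector R e (shift (B s) (ε s)))⟫_ℂ).re := by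
  have h1 := inner_sub_apply h.reduced (h.bddShift t) (h.spec s) (h.spec t)
  rw [h.inner_eq s, ← inner_conj_symm _ e, h.inner_eq t, map_zero, sub_zero] at h1
  set u := corrector R e (shift (B s) (ε s))
  set v := corrector R e (shift (B t) (ε t))
  have h2 : (shift (B s) (ε s) - shift (B t) (ε t)) u = (B s - B t) u - (ε s - ε t) • u := by
    rw [sub_apply, sub_apply, shift_apply, shift_apply, sub_smul]; abel
  rw [h2, inner_sub_right, inner_smul_right_eq_smul, sub_eq_zero] at h1
  rw [h1, Complex.real_smul, Complex.re_ofReal_mul]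

lemma two_thirds_le (h : IsPerturbedFamily R e b w w₁ w₂ B B' B'' ε) (s t : ℝ) :
    2 / 3 ≤ (⟪corrector R e (shift (B t) (ε t)), corrector R e (shift (B s) (ε s))⟫_ℂ).re :=
  two_thirds_le_re_inner h.reduced h.gap (h.bddShift s) (h.bddShift t) (h.spec s) (h.spec t)

lemma continuous_shift (h : IsPerturbedFamily R e b w w₁ w₂ B B' B'' ε) : Continuous ε := by
  rw [continuous_iff_continuousAt]
  intro t
  -- The constant is `4 / (2/3)`: the two correctors have norm at most `2`, and their inner product
  -- has real part at least `2/3`.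
  have h1 : ∀ s, |ε s - ε t| ≤ 6 * ‖B s - B t‖ := by
    intro s
    have hc := h.cross s t
    have h2 := h.two_thirds_le s t
    have hs := norm_le_two h.reduced h.gap (h.bddShift s) (h.spec s)
    have ht := norm_le_two h.reduced h.gap (h.bddShift t) (h.spec t)
    set u := corrector R e (shift (B s) (ε s))
    set v := corrector R e (shift (B t) (ε t))
    have h3 : |(⟪v, (B s - B t) u⟫_ℂ).re| ≤ 4 * ‖B s - B t‖ :=
      calc _ ≤ ‖v‖ * ‖(B s - B t) u‖ :=
            (Complex.abs_re_le_norm _).trans (norm_inner_le_norm _ _)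
        _ ≤ 2 * (‖B s - B t‖ * 2) := by
            gcongr; exact (ContinuousLinearMap.le_opNorm _ _).trans (by gcongr)
        _ = _ := by ring
    rw [← hc, abs_mul, abs_of_pos (by linarith : 0 < (⟪v, u⟫_ℂ).re)] at h3
    nlinarith [abs_nonneg (ε s - ε t)]
  have h2 : Tendsto (fun s => 6 * ‖B s - B t‖) (𝓝 t) (𝓝 0) := by
    have : ContinuousAt (fun s => 6 * ‖B s - B t‖) t := by
      have := (h.hasDeriv t).continuousAt
      fun_prop
    simpa using this.tendsto
  rw [ContinuousAt, tendsto_iff_norm_sub_tendsto_zero]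
  exact squeeze_zero (fun s => norm_nonneg _) h1 h2

lemma continuous_inverse (h : IsPerturbedFamily R e b w w₁ w₂ B B' B'' ε) :
    Continuous fun t => Ring.inverse (1 + R * shift (B t) (ε t)) := by
  refine continuous_inverse_one_add h.reduced h.gap h.bddShift ?_
  have h1 := h.continuous_shift
  have h2 := h.continuous_family
  unfold shift
  fun_prop

lemma continuous_corrector (h : IsPerturbedFamily R e b w w₁ w₂ B B' B'' ε) :
    Continuous fun t => corrector R e (shift (B t) (ε t)) :=
  h.continuous_inverse.clm_apply continuous_const

/-- The first derivative of the eigenvalue. -/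
def eigSlope (R : H →L[ℂ] H) (e : H) (B B' : ℝ → H →L[ℂ] H) (ε : ℝ → ℝ) (t : ℝ) : ℝ :=
  (⟪corrector R e (shift (B t) (ε t)), B' t (corrector R e (shift (B t) (ε t)))⟫_ℂ).re /
    ‖corrector R e (shift (B t) (ε t))‖ ^ 2

lemma norm_sq_pos (h : IsPerturbedFamily R e b w w₁ w₂ B B' B'' ε) (t : ℝ) :
    0 < ‖corrector R e (shift (B t) (ε t))‖ ^ 2 := by
  rw [norm_sq_eq h.reduced (h.spec t)]; positivity

lemma hasDerivAt_shift (h : IsPerturbedFamily R e b w w₁ w₂ B B' B'' ε) (t : ℝ) :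
    HasDerivAt ε (eigSlope R e B B' ε t) t := by
  rw [hasDerivAt_iff_tendsto_slope]
  have h1 := hasDerivAt_iff_tendsto_slope.1 (h.hasDeriv t)
  have h2 := h.continuous_corrector
  set u : ℝ → H := fun t => corrector R e (shift (B t) (ε t)) with hu
  have h3 : Tendsto u (𝓝[≠] t) (𝓝 (u t)) := (h2.tendsto t).mono_left nhdsWithin_le_nhds
  have h4 : Tendsto (fun s => (⟪u t, (slope B t s) (u s)⟫_ℂ).re / (⟪u t, u s⟫_ℂ).re)
      (𝓝[≠] t) (𝓝 ((⟪u t, B' t (u t)⟫_ℂ).re / (⟪u t, u t⟫_ℂ).re)) := by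
    refine Tendsto.div ?_ ?_ ?_
    · exact (Complex.continuous_re.tendsto _).comp (tendsto_const_nhds.inner
        ((isBoundedBilinearMap_apply (𝕜 := ℂ) (E := H) (F := H)).continuous.tendsto
          (B' t, u t) |>.comp (h1.prodMk_nhds h3)))
    · exact (Complex.continuous_re.tendsto _).comp (tendsto_const_nhds.inner h3)
    · have := h.two_thirds_le t t
      have h5 : (2 : ℝ) / 3 ≤ (⟪u t, u t⟫_ℂ).re := this
      linarith
  have h5 : (⟪u t, u t⟫_ℂ).re = ‖u t‖ ^ 2 := by
    rw [← RCLike.re_to_complex, inner_self_eq_norm_sq]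
  rw [h5] at h4
  refine h4.congr' ?_
  filter_upwards [self_mem_nhdsWithin] with s hs
  have hc : (ε s - ε t) * (⟪u t, u s⟫_ℂ).re = (⟪u t, (B s - B t) (u s)⟫_ℂ).re := h.cross s t
  have hp : (2 : ℝ) / 3 ≤ (⟪u t, u s⟫_ℂ).re := h.two_thirds_le s t
  have hst : s - t ≠ 0 := sub_ne_zero.2 hs
  rw [slope, slope, vsub_eq_sub, vsub_eq_sub, smul_apply,
    inner_smul_right_eq_smul, Complex.real_smul, Complex.re_ofReal_mul, ← hc, smul_eq_mul]
  have : (⟪u t, u s⟫_ℂ).re ≠ 0 := by linarith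
  field_simp

/-- The derivative of the corrector. -/
def correctorDeriv (R : H →L[ℂ] H) (e : H) (B B' : ℝ → H →L[ℂ] H) (ε : ℝ → ℝ) (t : ℝ) : H :=
  -(Ring.inverse (1 + R * shift (B t) (ε t))
    (R (shift (B' t) (eigSlope R e B B' ε t) (corrector R e (shift (B t) (ε t))))))

lemma hasDerivAt_corrector (h : IsPerturbedFamily R e b w w₁ w₂ B B' B'' ε) (t : ℝ) :
    HasDerivAt (fun t => corrector R e (shift (B t) (ε t))) (correctorDeriv R e B B' ε t) t := by
  have h1 : HasDerivAt (fun t => shift (B t) (ε t)) (shift (B' t) (eigSlope R e B B' ε t)) t :=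
    (h.hasDeriv t).sub ((h.hasDerivAt_shift t).smul_const _)
  exact EdgePotential.hasDerivAt_corrector h.reduced h.gap h.bddShift h1

lemma continuous_slope (h : IsPerturbedFamily R e b w w₁ w₂ B B' B'' ε) :
    Continuous (eigSlope R e B B' ε) := by
  have h1 := h.continuous_corrector
  have h2 := h.continuous_family'
  refine Continuous.div ?_ (by fun_prop) fun t => (h.norm_sq_pos t).ne'
  exact Complex.continuous_re.comp (h1.inner (h2.clm_apply h1))

lemma continuous_correctorDeriv (h : IsPerturbedFamily R e b w w₁ w₂ B B' B'' ε) :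
    Continuous (correctorDeriv R e B B' ε) := by
  have h1 := h.continuous_corrector
  have h2 := h.continuous_family'
  have h3 := h.continuous_slope
  refine (h.continuous_inverse.clm_apply (R.continuous.comp (Continuous.clm_apply ?_ h1))).neg
  unfold shift
  fun_prop

/-- The second derivative of the eigenvalue. -/
def eigSlopeDeriv (R : H →L[ℂ] H) (e : H) (B B' B'' : ℝ → H →L[ℂ] H) (ε : ℝ → ℝ) (t : ℝ) : ℝ :=
  ((⟪corrector R e (shift (B t) (ε t)), B'' t (corrector R e (shift (B t) (ε t)))⟫_ℂ).re +
    2 * (⟪correctorDeriv R e B B' ε t,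
      shift (B' t) (eigSlope R e B B' ε t) (corrector R e (shift (B t) (ε t)))⟫_ℂ).re) /
    ‖corrector R e (shift (B t) (ε t))‖ ^ 2

lemma hasDerivAt_slope (h : IsPerturbedFamily R e b w w₁ w₂ B B' B'' ε) (t : ℝ) :
    HasDerivAt (eigSlope R e B B' ε) (eigSlopeDeriv R e B B' B'' ε t) t := by
  have h1 := h.hasDerivAt_corrector t
  have h2 : HasDerivAt (fun t => B' t (corrector R e (shift (B t) (ε t))))
    (B'' t (corrector R e (shift (B t) (ε t))) + B' t (correctorDeriv R e B B' ε t)) t :=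
    ((ContinuousLinearMap.restrictScalarsL ℂ H H ℝ ℝ).hasFDerivAt.comp_hasDerivAt t
      (h.hasDeriv' t)).clm_apply h1
  have h3 := Complex.reCLM.hasFDerivAt.comp_hasDerivAt t (h1.inner ℂ h2)
  have h4 := Complex.reCLM.hasFDerivAt.comp_hasDerivAt t (h1.inner ℂ h1)
  have hp := h.norm_sq_pos t
  have hn : ∀ x : H, (⟪x, x⟫_ℂ).re = ‖x‖ ^ 2 := fun x => by
    rw [← RCLike.re_to_complex, inner_self_eq_norm_sq]
  have h5 := h3.div h4 (by simp only [Function.comp, Complex.reCLM_apply, hn]; exact hp.ne')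
  refine (h5.congr_of_eventuallyEq (Eventually.of_forall fun s => ?_)).congr_deriv ?_
  · simp only [eigSlope, Function.comp, Complex.reCLM_apply, Pi.div_apply, hn]
  · symm
    simp only [eigSlopeDeriv, Function.comp, Complex.reCLM_apply, hn, shift_apply, Complex.add_re]
    -- With `m` the slope, the derivative of the denominator contributes `-2 m Re ⟪u', u⟫`, which
    -- replaces `B'` by `B' - m` in the cross term.
    have hs : (⟪corrector R e (shift (B t) (ε t)), B' t (corrector R e (shift (B t) (ε t)))⟫_ℂ).re
      = eigSlope R e B B' ε t * ‖corrector R e (shift (B t) (ε t))‖ ^ 2 := by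
      rw [eigSlope, div_mul_cancel₀ _ hp.ne']
    have hsym : (⟪corrector R e (shift (B t) (ε t)), B' t (correctorDeriv R e B B' ε t)⟫_ℂ).re =
      (⟪correctorDeriv R e B B' ε t, B' t (corrector R e (shift (B t) (ε t)))⟫_ℂ).re := by
      rw [← (h.symm' t).symm, ← inner_conj_symm, Complex.conj_re]
    have hsym2 : (⟪corrector R e (shift (B t) (ε t)), correctorDeriv R e B B' ε t⟫_ℂ).re =
      (⟪correctorDeriv R e B B' ε t, corrector R e (shift (B t) (ε t))⟫_ℂ).re := by
      rw [← inner_conj_symm, Complex.conj_re]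
    rw [inner_add_right, Complex.add_re, inner_sub_right, Complex.sub_re, hs, hsym, hsym2,
      inner_smul_right_eq_smul, Complex.real_smul, Complex.re_ofReal_mul]
    field_simp
    ring

lemma continuous_eigSlopeDeriv (h : IsPerturbedFamily R e b w w₁ w₂ B B' B'' ε) :
    Continuous (eigSlopeDeriv R e B B' B'' ε) := by
  have h1 := h.continuous_corrector
  have h2 := h.continuous_family'
  have h3 := h.continuous_slope
  have h4 := h.continuous_correctorDeriv
  have h5 := h.cont''
  refine Continuous.div ?_ (by fun_prop) fun t => (h.norm_sq_pos t).ne'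
  refine (Complex.continuous_re.comp (h1.inner (h5.clm_apply h1))).add
    (continuous_const.mul (Complex.continuous_re.comp (h4.inner (Continuous.clm_apply ?_ h1))))
  unfold shift
  fun_prop

lemma contDiff_shift (h : IsPerturbedFamily R e b w w₁ w₂ B B' B'' ε) : ContDiff ℝ 2 ε := by
  have h1 : deriv ε = eigSlope R e B B' ε := funext fun t => (h.hasDerivAt_shift t).deriv
  have h2 : deriv (eigSlope R e B B' ε) = eigSlopeDeriv R e B B' B'' ε :=
    funext fun t => (h.hasDerivAt_slope t).deriv
  rw [show (2 : WithTop ℕ∞) = 1 + 1 by norm_num, contDiff_succ_iff_deriv]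
  refine ⟨fun t => (h.hasDerivAt_shift t).differentiableAt, by simp, ?_⟩
  rw [h1, contDiff_one_iff_deriv, h2]
  exact ⟨fun t => (h.hasDerivAt_slope t).differentiableAt, h.continuous_eigSlopeDeriv⟩

lemma iteratedDeriv_shift (h : IsPerturbedFamily R e b w w₁ w₂ B B' B'' ε) :
    iteratedDeriv 2 ε = eigSlopeDeriv R e B B' B'' ε := by
  rw [iteratedDeriv_succ, iteratedDeriv_one,
    (funext fun t => (h.hasDerivAt_shift t).deriv : _root_.deriv ε = eigSlope R e B B' ε)]
  exact funext fun t => (h.hasDerivAt_slope t).deriv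

/-- The derivative `u'` solves `u' + R (A u') = -R ((B' - m) u)`, whence `b ‖u'‖ ≤ ‖(B' - m) u‖`. As
`m` is the mean of `B'` in the state `u`, the variance `‖(B' - m) u‖² = ‖B' u‖² - m² ‖u‖²` is at
most `w₁² ‖u‖²`. This bounds the cross term by `2 w₁² / b`. -/
lemma abs_eigSlopeDeriv_sub_le (h : IsPerturbedFamily R e b w w₁ w₂ B B' B'' ε) (hw₂ : 0 ≤ w₂)
    (t : ℝ) :
    |eigSlopeDeriv R e B B' B'' ε t - (⟪e, B'' t e⟫_ℂ).re| ≤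
      2 * w * w₂ / b + 2 * w₁ ^ 2 / b := by
  have h1 := abs_re_inner_sub_le h.reduced (h.bddShift t) (h.symm'' t) hw₂ (h.spec t)
  have hp := h.norm_sq_pos t
  have hb := h.reduced.pos
  have hs : (⟪corrector R e (shift (B t) (ε t)), B' t (corrector R e (shift (B t) (ε t)))⟫_ℂ).re
      = eigSlope R e B B' ε t * ‖corrector R e (shift (B t) (ε t))‖ ^ 2 := by
    rw [eigSlope, div_mul_cancel₀ _ hp.ne']
  have h2 : b * ‖correctorDeriv R e B B' ε t‖ ≤
      ‖shift (B' t) (eigSlope R e B B' ε t) (corrector R e (shift (B t) (ε t)))‖ := by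
    have hi := Ring.mul_inverse_cancel _ (isUnit_one_add h.reduced h.gap (h.bddShift t))
    rw [correctorDeriv, norm_neg]
    refine norm_le_of_add_eq h.reduced h.gap (h.bddShift t) ?_
    exact congrArg (fun T : H →L[ℂ] H => T _) hi
  rw [eigSlopeDeriv]
  set u := corrector R e (shift (B t) (ε t))
  set v := correctorDeriv R e B B' ε t
  set m := eigSlope R e B B' ε t
  have h3 : ‖shift (B' t) m u‖ ^ 2 ≤ w₁ ^ 2 * ‖u‖ ^ 2 := by
    rw [shift_apply, norm_sub_sq (𝕜 := ℂ), norm_smul, inner_smul_right_eq_smul, (h.symm' t).symm]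
    simp only [Complex.real_smul, RCLike.re_to_complex, Complex.re_ofReal_mul, Real.norm_eq_abs,
      mul_pow, sq_abs, hs]
    have h4 := pow_le_pow_left₀ (norm_nonneg _) ((h.symm' t).bound u) 2
    nlinarith [mul_nonneg (sq_nonneg m) hp.le]
  have h4 : |(⟪v, shift (B' t) m u⟫_ℂ).re| ≤ w₁ ^ 2 * ‖u‖ ^ 2 / b := by
    refine ((Complex.abs_re_le_norm _).trans (norm_inner_le_norm _ _)).trans ?_
    rw [le_div_iff₀ hb]
    nlinarith [norm_nonneg (shift (B' t) m u)]
  have h5 : |2 * (⟪v, shift (B' t) m u⟫_ℂ).re / ‖u‖ ^ 2| ≤ 2 * w₁ ^ 2 / b := by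
    rw [abs_div, abs_of_pos hp, div_le_iff₀ hp, abs_mul, abs_two]
    calc _ ≤ 2 * (w₁ ^ 2 * ‖u‖ ^ 2 / b) := by gcongr
      _ = _ := by ring
  calc _ = |((⟪u, B'' t u⟫_ℂ).re / ‖u‖ ^ 2 - (⟪e, B'' t e⟫_ℂ).re) +
        2 * (⟪v, shift (B' t) m u⟫_ℂ).re / ‖u‖ ^ 2| := by congr 1; ring
    _ ≤ _ := (abs_add_le _ _).trans (add_le_add h1 h5)

end IsPerturbedFamily

end Family

end EdgePotential

namespace EdgePotential

open scoped InnerProductSpace Topology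
open Filter

/-! ### Bounded perturbations of a diagonal operator -/

section Diagonal

variable {H : Type*} [NormedAddCommGroup H] [InnerProductSpace ℂ H]

/-- A bounded real sequence is the diagonal of a bounded operator. -/
lemma exists_diagonal (e : HilbertBasis ℕ ℂ H) (a : ℕ → ℝ) {C : ℝ} (hC : 0 ≤ C)
    (ha : ∀ l, |a l| ≤ C) :
    ∃ D : H →L[ℂ] H, (∀ l x, ⟪e l, D x⟫_ℂ = a l * ⟪e l, x⟫_ℂ) ∧ ∀ x, ‖D x‖ ≤ C * ‖x‖ := by
  have hmem : ∀ f : lp (fun _ : ℕ => ℂ) 2, Memℓp (fun l => (a l : ℂ) * f l) 2 := by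
    intro f
    refine ((lp.memℓp f).const_smul (C : ℂ)).mono' fun l => ?_
    rw [norm_mul, Pi.smul_apply, norm_smul]
    gcongr
    simpa [abs_of_nonneg hC] using ha l
  let T : lp (fun _ : ℕ => ℂ) 2 →ₗ[ℂ] lp (fun _ : ℕ => ℂ) 2 :=
    { toFun := fun f => ⟨fun l => (a l : ℂ) * f l, hmem f⟩
      map_add' := fun f g => by ext l; exact mul_add _ _ _
      map_smul' := fun c f => by ext l; exact mul_left_comm _ _ _ }
  have hT : ∀ f, ‖T f‖ ≤ C * ‖f‖ := by
    intro f
    rw [← abs_of_nonneg hC, ← Real.norm_eq_abs, ← norm_smul]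
    refine lp.norm_mono (by norm_num) fun l => ?_
    change ‖(a l : ℂ) * f l‖ ≤ ‖C • f l‖
    rw [norm_mul, norm_smul]
    gcongr
    simpa [abs_of_nonneg hC] using ha l
  let D : H →L[ℂ] H := (e.repr.symm : lp (fun _ : ℕ => ℂ) 2 →L[ℂ] H) ∘L
    (T.mkContinuous C hT) ∘L (e.repr : H →L[ℂ] lp (fun _ : ℕ => ℂ) 2)
  refine ⟨D, fun l x => ?_, fun x => ?_⟩
  · rw [← e.repr_apply_apply, ← e.repr_apply_apply]
    simp [D, T]
  · simpa [D] using hT (e.repr x)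

lemma ext_basis (e : HilbertBasis ℕ ℂ H) {x y : H} (h : ∀ l, ⟪e l, x⟫_ℂ = ⟪e l, y⟫_ℂ) : x = y := by
  apply e.repr.injective
  ext l
  rw [e.repr_apply_apply, e.repr_apply_apply, h l]

lemma inner_basis (e : HilbertBasis ℕ ℂ H) (l j : ℕ) :
    ⟪e l, e j⟫_ℂ = if l = j then 1 else 0 :=
  orthonormal_iff_ite.1 e.orthonormal l j

/-- The convention `0⁻¹ = 0` makes the entry at `l = j` vanish, which gives `R e_j = 0`; for `l ≠
j`, `|l - j| ≥ 1` gives the bound. -/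
lemma exists_reducedResolvent (e : HilbertBasis ℕ ℂ H) {b : ℝ} (hb : 0 < b) (j : ℕ) :
    ∃ R : H →L[ℂ] H, IsReducedResolvent R (e j) b ∧
      ∀ l x, ⟪e l, R x⟫_ℂ = ((2 * b * ((l : ℝ) - j))⁻¹ : ℝ) * ⟪e l, x⟫_ℂ := by
  obtain ⟨R, h1, h2⟩ := exists_diagonal e (fun l => (2 * b * ((l : ℝ) - j))⁻¹) (C := (2 * b)⁻¹)
    (by positivity) fun l => by
      rcases eq_or_ne l j with rfl | h
      · simp; positivity
      · have h3 : (1 : ℝ) ≤ |(l : ℝ) - j| := by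
          have : (1 : ℤ) ≤ |(l : ℤ) - j| := Int.one_le_abs (by omega)
          exact_mod_cast this
        rw [abs_inv, abs_mul, abs_of_pos (by positivity : 0 < 2 * b)]
        exact inv_anti₀ (by positivity) (le_mul_of_one_le_right (by positivity) h3)
  refine ⟨R, ⟨hb, fun x y => ?_, ?_, e.orthonormal.1 j, fun x => ?_⟩, h1⟩
  · rw [← (e.hasSum_inner_mul_inner (R x) y).tsum_eq, ← (e.hasSum_inner_mul_inner x (R y)).tsum_eq]
    refine tsum_congr fun l => ?_
    rw [h1, ← inner_conj_symm (R x), h1, map_mul, inner_conj_symm, Complex.conj_ofReal]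
    ring
  · refine ext_basis e fun l => ?_
    rw [h1, inner_basis, inner_zero_right]
    split_ifs with h
    · simp [h]
    · simp
  · have := h2 x
    rw [inv_mul_eq_div, le_div_iff₀ (by positivity)] at this
    linarith

/-- The eigenvalues of `D + B`, where `D` is diagonal with the eigenvalues `(2 l + 1) b`. -/
def diagEigenvalues (e : HilbertBasis ℕ ℂ H) (b : ℝ) (B : H →L[ℂ] H) : Set ℝ :=
  {μ | ∃ u : H, u ≠ 0 ∧ ∀ l, ⟪e l, B u⟫_ℂ = ((μ - (2 * l + 1) * b : ℝ) : ℂ) * ⟪e l, u⟫_ℂ}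

/-- If `μ` were farther than `w` from every level, Parseval would give `‖B u‖ > w ‖u‖`; the
inequality is strict at a nonzero coefficient of `u`. -/
lemma exists_abs_sub_le (e : HilbertBasis ℕ ℂ H) {b w : ℝ} (hw : 0 ≤ w) {B : H →L[ℂ] H}
    (hB : IsSymmBdd B w) {μ : ℝ} (hμ : μ ∈ diagEigenvalues e b B) :
    ∃ l : ℕ, |μ - (2 * l + 1) * b| ≤ w := by
  obtain ⟨u, hu, h⟩ := hμ
  by_contra! hc
  have hP : ∀ x : H, HasSum (fun l => ‖⟪e l, x⟫_ℂ‖ ^ 2) (‖x‖ ^ 2) := by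
    intro x
    have h1 := (e.hasSum_inner_mul_inner x x).mapL Complex.reCLM
    rw [Complex.reCLM_apply, ← RCLike.re_to_complex, inner_self_eq_norm_sq] at h1
    refine h1.congr_fun ?_
    intro l
    rw [← inner_conj_symm x (e l), ← Complex.normSq_eq_conj_mul_self, Complex.reCLM_apply,
      Complex.ofReal_re, Complex.normSq_eq_norm_sq]
  have h1 := (hP u).mul_left (w ^ 2)
  have h2 := hP (B u)
  have hterm : ∀ l, ‖⟪e l, B u⟫_ℂ‖ ^ 2 = |μ - (2 * l + 1) * b| ^ 2 * ‖⟪e l, u⟫_ℂ‖ ^ 2 := by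
    intro l
    rw [h l, norm_mul, mul_pow, Complex.norm_real, Real.norm_eq_abs]
  have hne : ∃ l, ⟪e l, u⟫_ℂ ≠ 0 := by
    by_contra! h0
    exact hu (ext_basis e fun l => by rw [h0 l, inner_zero_right])
  obtain ⟨l₀, hl₀⟩ := hne
  have hlt : w ^ 2 * ‖u‖ ^ 2 < ‖B u‖ ^ 2 := by
    refine hasSum_lt (i := l₀) (fun l => ?_) ?_ h1 h2
    · rw [hterm]
      have := (hc l).le
      gcongr
    · rw [hterm]
      have := hc l₀
      have h3 : 0 < ‖⟪e l₀, u⟫_ℂ‖ := norm_pos_iff.2 hl₀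
      gcongr
  have := pow_le_pow_left₀ (norm_nonneg _) (hB.bound u) 2
  rw [mul_pow] at this
  linarith

variable {e : HilbertBasis ℕ ℂ H} {b w : ℝ} {j : ℕ} {R : H →L[ℂ] H}

lemma add_apply_eq_smul
    (hR' : ∀ l x, ⟪e l, R x⟫_ℂ = ((2 * b * ((l : ℝ) - j))⁻¹ : ℝ) * ⟪e l, x⟫_ℂ) (hb : 0 < b)
    {B : H →L[ℂ] H} {μ : ℝ} {u : H}
    (hu : ∀ l, ⟪e l, B u⟫_ℂ = ((μ - (2 * l + 1) * b : ℝ) : ℂ) * ⟪e l, u⟫_ℂ) :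
    u + R (shift B (μ - (2 * j + 1) * b) u) = ⟪e j, u⟫_ℂ • e j ∧
      ⟪e j, shift B (μ - (2 * j + 1) * b) u⟫_ℂ = 0 := by
  have h1 : ∀ l, ⟪e l, shift B (μ - (2 * j + 1) * b) u⟫_ℂ =
      ((-(2 * b * ((l : ℝ) - j)) : ℝ) : ℂ) * ⟪e l, u⟫_ℂ := by
    intro l
    rw [shift_apply, inner_sub_right, inner_smul_right_eq_smul, hu, Complex.real_smul]
    push_cast; ring
  refine ⟨ext_basis e fun l => ?_, by rw [h1]; simp⟩
  rw [inner_add_right, hR', h1, inner_smul_right, inner_basis]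
  split_ifs with h
  · simp [h]
  · have : (l : ℝ) - j ≠ 0 := sub_ne_zero.2 (by exact_mod_cast h)
    have h2 : (2 * b * ((l : ℝ) - j))⁻¹ * (-(2 * b * ((l : ℝ) - j))) = -1 := by field_simp
    rw [← mul_assoc, ← Complex.ofReal_mul, h2]
    simp

/-- For `l ≠ j` the entry of `R` can be inverted in the `l`-th coefficient; for `l = j` the missing
equation is the orthogonality condition `hg`. -/
lemma inner_eq_of_add_apply_eq
    (hR' : ∀ l x, ⟪e l, R x⟫_ℂ = ((2 * b * ((l : ℝ) - j))⁻¹ : ℝ) * ⟪e l, x⟫_ℂ) (hb : 0 < b)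
    {B : H →L[ℂ] H} {ε : ℝ} {u : H} (hu : u + R (shift B ε u) = e j)
    (hg : ⟪e j, shift B ε u⟫_ℂ = 0) (l : ℕ) :
    ⟪e l, B u⟫_ℂ = (((2 * j + 1) * b + ε - (2 * l + 1) * b : ℝ) : ℂ) * ⟪e l, u⟫_ℂ := by
  have h1 : ⟪e l, B u⟫_ℂ = ⟪e l, shift B ε u⟫_ℂ + ε * ⟪e l, u⟫_ℂ := by
    rw [shift_apply, inner_sub_right, inner_smul_right_eq_smul, Complex.real_smul]; ring
  rcases eq_or_ne l j with rfl | h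
  · rw [h1, hg]; push_cast; ring
  · have h2 : ⟪e l, u⟫_ℂ + ⟪e l, R (shift B ε u)⟫_ℂ = 0 := by
      rw [← inner_add_right, hu, inner_basis, if_neg h]
    have h3 : (l : ℝ) - j ≠ 0 := sub_ne_zero.2 (by exact_mod_cast h)
    have h4 : ((2 * b * ((l : ℝ) - j) : ℝ) : ℂ) * ((2 * b * ((l : ℝ) - j))⁻¹ : ℝ) = 1 := by
      rw [← Complex.ofReal_mul, mul_inv_cancel₀ (by positivity), Complex.ofReal_one]
    have h5 : ⟪e l, shift B ε u⟫_ℂ = -((2 * b * ((l : ℝ) - j) : ℝ) : ℂ) * ⟪e l, u⟫_ℂ := by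
      rw [hR'] at h2
      linear_combination (-⟪e l, shift B ε u⟫_ℂ) * h4 + ((2 * b * ((l : ℝ) - j) : ℝ) : ℂ) * h2
    rw [h1, h5]; push_cast; ring

/-- An eigenvector orthogonal to `e j` would solve `v + R (A v) = 0` and vanish. So it can be scaled
to have coefficient `1`, and `shift_unique` applies. -/
lemma shift_unique_of_mem (hR : IsReducedResolvent R (e j) b)
    (hR' : ∀ l x, ⟪e l, R x⟫_ℂ = ((2 * b * ((l : ℝ) - j))⁻¹ : ℝ) * ⟪e l, x⟫_ℂ)
    (hwb : 2 * w < b) {B : H →L[ℂ] H} (hB : IsSymmBdd B w) {μ ε : ℝ} {u : H}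
    (hμ : μ ∈ diagEigenvalues e b B) (hμj : |μ - (2 * j + 1) * b| ≤ w) (hε : |ε| ≤ w)
    (hu : u + R (shift B ε u) = e j)
    (hg : ⟪e j, shift B ε u⟫_ℂ = 0) : μ = (2 * j + 1) * b + ε := by
  obtain ⟨v, hv, h⟩ := hμ
  obtain ⟨h1, h2⟩ := add_apply_eq_smul hR' hR.pos h
  have hc : ⟪e j, v⟫_ℂ ≠ 0 := by
    intro h0
    rw [h0, zero_smul, ← map_zero R] at h1
    have h3 := norm_le_of_add_eq hR hwb (hB.shift hμj) h1
    rw [norm_zero] at h3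
    have := hR.pos
    have h4 : ‖v‖ ≤ 0 := by
      by_contra! h5
      have := mul_pos this h5
      linarith
    exact hv (norm_le_zero_iff.1 h4)
  have h3 := shift_unique hR hwb hB hμj hε (u₁ := (⟪e j, v⟫_ℂ)⁻¹ • v) (u₂ := u) (by
      rw [map_smul, map_smul, ← smul_add, h1, smul_smul, inv_mul_cancel₀ hc, one_smul]) hu
    (by rw [map_smul, inner_smul_right, h2, mul_zero]) hg
  linarith

lemma mem_diagEigenvalues (hR : IsReducedResolvent R (e j) b)
    (hR' : ∀ l x, ⟪e l, R x⟫_ℂ = ((2 * b * ((l : ℝ) - j))⁻¹ : ℝ) * ⟪e l, x⟫_ℂ)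
    {B : H →L[ℂ] H} {ε : ℝ} {u : H} (hu : u + R (shift B ε u) = e j)
    (hg : ⟪e j, shift B ε u⟫_ℂ = 0) : (2 * j + 1) * b + ε ∈ diagEigenvalues e b B := by
  refine ⟨u, fun h0 => ?_, inner_eq_of_add_apply_eq hR' hR.pos hu hg⟩
  have := inner_eq_one hR hu
  simp [h0] at this

/-- A set of reals which meets each of the disjoint intervals `|μ - (2 l + 1) b| ≤ w` in one point
and has no other points is enumerated by `l`. -/
lemma nth_of_clusters {S : Set ℝ} (hb : 2 * w < b)
    (hS : ∀ μ ∈ S, ∃ l : ℕ, |μ - (2 * l + 1) * b| ≤ w)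
    {F : ℕ → ℝ} (hF : ∀ l, F l ∈ S) (hFw : ∀ l : ℕ, |F l - (2 * l + 1) * b| ≤ w)
    (huniq : ∀ l : ℕ, ∀ μ ∈ S, |μ - (2 * l + 1) * b| ≤ w → μ = F l) (j : ℕ) (μ : ℝ) :
    (μ ∈ S ∧ {ν ∈ S | ν < μ}.encard + 1 = ((j + 1 : ℕ) : ℕ∞)) ↔ μ = F j := by
  have hw : 0 ≤ w := (abs_nonneg _).trans (hFw 0)
  -- The clusters are ordered: `(2l + 1) b + w < (2l + 3) b - w`.
  have hmono : StrictMono F := strictMono_nat_of_lt_succ fun l => by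
    have h1 := (abs_le.1 (hFw l)).2
    have h2 := (abs_le.1 (hFw (l + 1))).1
    push_cast at h2
    linarith
  have hcount : ∀ l, {ν ∈ S | ν < F l}.encard = l := by
    intro l
    have : {ν ∈ S | ν < F l} = F '' (Set.Iio l) := by
      ext ν
      constructor
      · rintro ⟨h1, h2⟩
        obtain ⟨m, hm⟩ := hS ν h1
        have := huniq m ν h1 hm
        subst this
        exact ⟨m, hmono.lt_iff_lt.1 h2, rfl⟩
      · rintro ⟨m, hm, rfl⟩
        exact ⟨hF m, hmono hm⟩
    rw [this, hmono.injective.encard_image]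
    simp [Set.encard_eq_coe_toFinset_card]
  constructor
  · rintro ⟨h1, h2⟩
    obtain ⟨m, hm⟩ := hS μ h1
    have := huniq m μ h1 hm
    subst this
    rw [hcount] at h2
    have : m + 1 = j + 1 := by exact_mod_cast h2
    rw [Nat.succ_injective this]
  · rintro rfl
    exact ⟨hF j, by rw [hcount]; norm_cast⟩

end Diagonal

end EdgePotential

namespace EdgePotential

open scoped InnerProductSpace Topology
open Filter Polynomial

/-! ### Hermite functions: equation, normalization, orthogonality -/

section Hermite

/-- A polynomial times a Gaussian. -/
def polyGauss (a : ℝ) (P : ℝ[X]) (x : ℝ) : ℝ := P.eval x * Real.exp (-a * x ^ 2)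

/-- The polynomial factor of the derivative of `polyGauss a P`. -/
def gaussDeriv (a : ℝ) (P : ℝ[X]) : ℝ[X] := derivative P - C (2 * a) * X * P

lemma hasDerivAt_polyGauss (a : ℝ) (P : ℝ[X]) (x : ℝ) :
    HasDerivAt (polyGauss a P) (polyGauss a (gaussDeriv a P) x) x := by
  have h1 : HasDerivAt (fun x : ℝ => Real.exp (-a * x ^ 2))
      (Real.exp (-a * x ^ 2) * (-a * (2 * x))) x := by
    have := ((hasDerivAt_pow 2 x).const_mul (-a)).exp
    simpa using this
  refine ((P.hasDerivAt x).mul h1).congr_deriv ?_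
  simp only [polyGauss, gaussDeriv, eval_sub, eval_mul, eval_C, eval_X]
  ring

lemma contDiff_polyGauss (a : ℝ) (P : ℝ[X]) : ContDiff ℝ ∞ (polyGauss a P) := by
  have h1 : ContDiff ℝ ∞ fun x => P.eval x := by simpa using P.contDiff_aeval ∞ (𝕜 := ℝ)
  unfold polyGauss
  fun_prop

lemma continuous_polyGauss (a : ℝ) (P : ℝ[X]) : Continuous (polyGauss a P) :=
  (contDiff_polyGauss a P).continuous

lemma integrable_polyGauss {a : ℝ} (ha : 0 < a) (P : ℝ[X]) : Integrable (polyGauss a P) := by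
  induction P using Polynomial.induction_on' with
  | add p q hp hq =>
    refine (hp.add hq).congr (Eventually.of_forall fun x => ?_)
    simp [polyGauss, add_mul]
  | monomial n c =>
    have h := (integrable_rpow_mul_exp_neg_mul_sq ha (s := n)
      (by have : (0 : ℝ) ≤ n := n.cast_nonneg; linarith)).const_mul c
    refine h.congr (Eventually.of_forall fun x => ?_)
    simp [polyGauss, mul_assoc]

lemma polyGauss_mul (a a' : ℝ) (P Q : ℝ[X]) (x : ℝ) :
    polyGauss a P x * polyGauss a' Q x = polyGauss (a + a') (P * Q) x := by
  simp only [polyGauss, eval_mul]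
  rw [show -(a + a') * x ^ 2 = -a * x ^ 2 + -a' * x ^ 2 by ring, Real.exp_add]
  ring

lemma memLp_polyGauss {a : ℝ} (ha : 0 < a) (P : ℝ[X]) : MemLp (polyGauss a P) 2 := by
  rw [memLp_two_iff_integrable_sq (continuous_polyGauss a P).aestronglyMeasurable]
  refine (integrable_polyGauss (a := a + a) (by linarith) (P * P)).congr
    (Eventually.of_forall fun x => ?_)
  simp only [sq, polyGauss_mul]

lemma integral_polyGauss_gaussDeriv {a : ℝ} (ha : 0 < a) (P : ℝ[X]) :
    ∫ x, polyGauss a (gaussDeriv a P) x = 0 :=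
  integral_eq_zero_of_hasDerivAt_of_integrable (hasDerivAt_polyGauss a P)
    (integrable_polyGauss ha _) (integrable_polyGauss ha _)

lemma derivative_hermite_succ (n : ℕ) :
    derivative (hermite (n + 1)) = (n + 1 : ℤ[X]) * hermite n := by
  induction n with
  | zero => simp
  | succ n ih =>
    have h : derivative (hermite (n + 2)) = hermite (n + 1) + X * derivative (hermite (n + 1)) -
        derivative (derivative (hermite (n + 1))) := by
      rw [hermite_succ (n + 1)]; simp
    have h2 : derivative (derivative (hermite (n + 1))) =
        (n + 1 : ℤ[X]) * derivative (hermite n) := by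
      rw [ih, derivative_mul]; simp
    rw [h, h2, ih, hermite_succ n]
    push_cast; ring

lemma hermite_ode (n : ℕ) :
    derivative (derivative (hermite n)) = X * derivative (hermite n) - (n : ℤ[X]) * hermite n := by
  have h := derivative_hermite_succ n
  rw [hermite_succ, derivative_sub, derivative_mul, derivative_X] at h
  linear_combination -h

/-- The Hermite polynomial with real coefficients. -/
def hermiteReal (n : ℕ) : ℝ[X] := (hermite n).map (Int.castRingHom ℝ)

lemma derivative_hermiteReal_succ (n : ℕ) :
    derivative (hermiteReal (n + 1)) = (n + 1 : ℝ[X]) * hermiteReal n := by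
  simpa [hermiteReal] using
    congrArg (Polynomial.map (Int.castRingHom ℝ)) (derivative_hermite_succ n)

lemma hermiteReal_succ (n : ℕ) :
    hermiteReal (n + 1) = X * hermiteReal n - derivative (hermiteReal n) := by
  simp [hermiteReal, hermite_succ]

lemma hermiteReal_ode (n : ℕ) :
    derivative (derivative (hermiteReal n)) =
      X * derivative (hermiteReal n) - (n : ℝ[X]) * hermiteReal n := by
  simpa [hermiteReal] using congrArg (Polynomial.map (Int.castRingHom ℝ)) (hermite_ode n)

/-- The derivative of `He_{n+1} He_n exp(-x²/2)` is `((n + 1) He_n² - He_{n+1}²) exp(-x²/2)`, and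
its integral is zero. -/
lemma integral_hermiteReal_sq (n : ℕ) :
    ∫ x, polyGauss (1 / 2) (hermiteReal n * hermiteReal n) x = n.factorial * √(2 * Real.pi) := by
  induction n with
  | zero =>
    simp only [polyGauss, hermiteReal, hermite_zero]
    have := integral_gaussian (1 / 2)
    simp only [map_one, Polynomial.map_one, mul_one, eval_one, one_mul, this,
      Nat.factorial_zero, Nat.cast_one]
    congr 1; ring
  | succ n ih =>
    have h0 := integral_polyGauss_gaussDeriv (a := 1 / 2) (by norm_num)
      (hermiteReal (n + 1) * hermiteReal n)
    have h1 : ∀ x, polyGauss (1 / 2) (gaussDeriv (1 / 2) (hermiteReal (n + 1) * hermiteReal n)) x =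
        (n + 1) * polyGauss (1 / 2) (hermiteReal n * hermiteReal n) x -
        polyGauss (1 / 2) (hermiteReal (n + 1) * hermiteReal (n + 1)) x := by
      intro x
      have h2 : gaussDeriv (1 / 2) (hermiteReal (n + 1) * hermiteReal n) =
          (n + 1 : ℝ[X]) * (hermiteReal n * hermiteReal n) -
          hermiteReal (n + 1) * hermiteReal (n + 1) := by
        rw [gaussDeriv, derivative_mul, derivative_hermiteReal_succ]
        have h3 : (C (2 * (1 / 2) : ℝ) : ℝ[X]) = 1 := by norm_num
        rw [h3]
        linear_combination hermiteReal (n + 1) * hermiteReal_succ n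
      rw [h2]
      simp only [polyGauss, eval_sub, eval_mul, eval_add, eval_one, eval_natCast]
      ring
    simp only [h1] at h0
    rw [integral_sub ((integrable_polyGauss (by norm_num) _).const_mul _)
      (integrable_polyGauss (by norm_num) _), integral_const_mul, ih, sub_eq_zero] at h0
    rw [← h0, Nat.factorial_succ]
    push_cast; ring

/-- The polynomial factor of `osc s n`. -/
def oscPoly (s : ℝ) (n : ℕ) : ℝ[X] :=
  C (√s / √(√Real.pi * n.factorial)) * (hermiteReal n).comp (C (√2 * s) * X)

/-- The normalized eigenfunctions of `-d²/dx² + s⁴ x²`. -/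
def osc (s : ℝ) (n : ℕ) (x : ℝ) : ℝ := √s * hermiteFun (n + 1) (s * x)

lemma osc_eq_polyGauss (s : ℝ) (n : ℕ) : osc s n = polyGauss (s ^ 2 / 2) (oscPoly s n) := by
  funext x
  have h1 : aeval (√2 * (s * x)) (hermite n) = (hermiteReal n).eval (√2 * s * x) := by
    rw [hermiteReal, eval_map, ← mul_assoc]; rfl
  simp only [osc, hermiteFun, polyGauss, oscPoly, add_tsub_cancel_right, h1, eval_mul, eval_C,
    eval_comp, eval_X]
  rw [show -(s * x) ^ 2 / 2 = -(s ^ 2 / 2) * x ^ 2 by ring]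
  ring

lemma gaussDeriv_gaussDeriv_oscPoly (s : ℝ) (n : ℕ) (x : ℝ) :
    (gaussDeriv (s ^ 2 / 2) (gaussDeriv (s ^ 2 / 2) (oscPoly s n))).eval x =
      (s ^ 4 * x ^ 2 - (2 * n + 1) * s ^ 2) * (oscPoly s n).eval x := by
  have h := congrArg (fun P : ℝ[X] => P.eval (√2 * s * x)) (hermiteReal_ode n)
  simp only [eval_sub, eval_mul, eval_X, eval_natCast] at h
  have h2 : √2 * √2 = 2 := Real.mul_self_sqrt (by norm_num)
  simp only [gaussDeriv, oscPoly, derivative_sub, derivative_mul, derivative_C, derivative_X,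
    derivative_comp, eval_sub, eval_mul, eval_add, eval_C, eval_X, eval_comp, zero_mul, zero_add,
    mul_one, h]
  generalize √s / √(√Real.pi * n.factorial) = c
  generalize eval (√2 * s * x) (hermiteReal n) = p
  generalize eval (√2 * s * x) (derivative (hermiteReal n)) = q
  linear_combination c * s ^ 2 * (√2 * s * x * q - n * p) * h2

/-- The derivative of `osc s n`. -/
def oscDeriv (s : ℝ) (n : ℕ) : ℝ → ℝ :=
  polyGauss (s ^ 2 / 2) (gaussDeriv (s ^ 2 / 2) (oscPoly s n))

lemma hasDerivAt_osc (s : ℝ) (n : ℕ) (x : ℝ) : HasDerivAt (osc s n) (oscDeriv s n x) x := by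
  rw [osc_eq_polyGauss]; exact hasDerivAt_polyGauss _ _ x

lemma hasDerivAt_oscDeriv (s : ℝ) (n : ℕ) (x : ℝ) :
    HasDerivAt (oscDeriv s n) ((s ^ 4 * x ^ 2 - (2 * n + 1) * s ^ 2) * osc s n x) x := by
  refine (hasDerivAt_polyGauss _ _ x).congr_deriv ?_
  rw [polyGauss, gaussDeriv_gaussDeriv_oscPoly, osc_eq_polyGauss, polyGauss]; ring

lemma memLp_osc {s : ℝ} (hs : 0 < s) (n : ℕ) : MemLp (osc s n) 2 := by
  rw [osc_eq_polyGauss]; exact memLp_polyGauss (by positivity) _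

lemma memLp_oscDeriv {s : ℝ} (hs : 0 < s) (n : ℕ) : MemLp (oscDeriv s n) 2 :=
  memLp_polyGauss (by positivity) _

lemma contDiff_osc (s : ℝ) (n : ℕ) : ContDiff ℝ ∞ (osc s n) := by
  rw [osc_eq_polyGauss]; exact contDiff_polyGauss _ _

lemma integral_comp_mul_mul {s : ℝ} (hs : 0 < s) (g : ℝ → ℝ) : s * ∫ x, g (s * x) = ∫ x, g x := by
  rw [Measure.integral_comp_mul_left, abs_of_pos (by positivity), smul_eq_mul, ← mul_assoc,
    mul_inv_cancel₀ hs.ne', one_mul]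

lemma integral_hermiteFun_sq (n : ℕ) : ∫ x, hermiteFun (n + 1) x ^ 2 = 1 := by
  have h := integral_hermiteReal_sq n
  rw [← integral_comp_mul_mul (s := √2) (by positivity)] at h
  have h1 : ∀ x, hermiteFun (n + 1) x ^ 2 = (√Real.pi * n.factorial)⁻¹ *
      polyGauss (1 / 2) (hermiteReal n * hermiteReal n) (√2 * x) := by
    intro x
    have h1 : aeval (√2 * x) (hermite n) = (hermiteReal n).eval (√2 * x) := by
      rw [hermiteReal, eval_map]; rfl
    simp only [hermiteFun, polyGauss, add_tsub_cancel_right, h1, eval_mul]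
    rw [div_pow, Real.sq_sqrt (by positivity), mul_pow, ← Real.exp_nat_mul]
    rw [show ((2 : ℕ) : ℝ) * (-x ^ 2 / 2) = -(1 / 2) * (√2 * x) ^ 2 by
      rw [mul_pow, Real.sq_sqrt (by norm_num)]; push_cast; ring]
    field_simp
  simp only [h1]
  rw [integral_const_mul]
  have h2 : √(2 * Real.pi) = √2 * √Real.pi := Real.sqrt_mul (by norm_num) _
  rw [h2] at h
  have h3 : √2 ≠ 0 := by positivity
  have h4 : ∫ x, polyGauss (1 / 2) (hermiteReal n * hermiteReal n) (√2 * x) =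
      √Real.pi * n.factorial := by
    apply mul_left_cancel₀ h3; rw [h]; ring
  rw [h4, inv_mul_cancel₀ (by positivity)]

lemma integral_osc_sq {s : ℝ} (hs : 0 < s) (n : ℕ) : ∫ x, osc s n x * osc s n x = 1 := by
  rw [← integral_hermiteFun_sq n, ← integral_comp_mul_mul hs (fun x => hermiteFun (n + 1) x ^ 2),
    ← integral_const_mul]
  congr 1
  funext x
  rw [osc, ← sq, mul_pow, Real.sq_sqrt hs.le]

/-- The product is, up to the factor `2 s² (m - n)`, the derivative of the Wronskian. -/
lemma integral_osc_mul_osc {s : ℝ} (hs : 0 < s) {n m : ℕ} (h : n ≠ m) :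
    ∫ x, osc s n x * osc s m x = 0 := by
  have hd : ∀ x, HasDerivAt (fun x => oscDeriv s n x * osc s m x - osc s n x * oscDeriv s m x)
      (2 * s ^ 2 * (m - n) * (osc s n x * osc s m x)) x := by
    intro x
    refine (((hasDerivAt_oscDeriv s n x).mul (hasDerivAt_osc s m x)).sub
      ((hasDerivAt_osc s n x).mul (hasDerivAt_oscDeriv s m x))).congr_deriv ?_
    ring
  have h1 := (memLp_osc hs n).integrable_mul (memLp_osc hs m)
  have h2 := (memLp_oscDeriv hs n).integrable_mul (memLp_osc hs m)
  have h3 := (memLp_osc hs n).integrable_mul (memLp_oscDeriv hs m)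
  have h0 := integral_eq_zero_of_hasDerivAt_of_integrable hd (h1.const_mul _) (h2.sub h3)
  rw [integral_const_mul] at h0
  have h4 : (m : ℝ) - n ≠ 0 := sub_ne_zero.2 (by exact_mod_cast h.symm)
  exact (mul_eq_zero.1 h0).resolve_left (by positivity)

end Hermite

end EdgePotential

namespace EdgePotential

open scoped InnerProductSpace Topology
open Filter Polynomial

/-! ### Completeness of the Hermite functions -/

section Complete

/-- The positive and negative parts of `g` are densities of finite measures with the same
characteristic function, hence equal measures. -/
lemma ae_eq_zero_of_integral_exp {g : ℝ → ℝ} (hg : Integrable g)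
    (h : ∀ t : ℝ, ∫ x, (g x : ℂ) * Complex.exp (t * x * Complex.I) = 0) : g =ᵐ[volume] 0 := by
  have hm := hg.aestronglyMeasurable.aemeasurable
  have e1 : AEMeasurable (fun x => ENNReal.ofReal (g x)) := hm.ennreal_ofReal
  have e2 : AEMeasurable (fun x => ENNReal.ofReal (-g x)) := hm.neg.ennreal_ofReal
  have f1 := isFiniteMeasure_withDensity_ofReal hg.2
  have f2 : IsFiniteMeasure (volume.withDensity fun x => ENNReal.ofReal (-g x)) :=
    isFiniteMeasure_withDensity_ofReal hg.neg.2
  have hexp : ∀ t x : ℝ, ‖Complex.exp (t * x * Complex.I)‖ = 1 := fun t x => by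
    rw [← Complex.ofReal_mul, Complex.norm_exp_ofReal_mul_I]
  have key : volume.withDensity (fun x => ENNReal.ofReal (g x)) =
      volume.withDensity (fun x => ENNReal.ofReal (-g x)) := by
    refine Measure.ext_of_charFun (funext fun t => ?_)
    rw [charFun_apply_real, charFun_apply_real,
      integral_withDensity_eq_integral_toReal_smul₀ e1 (by simp),
      integral_withDensity_eq_integral_toReal_smul₀ e2 (by simp), ← sub_eq_zero]
    have hi : ∀ k : ℝ → ℝ, Integrable k → Integrable fun x : ℝ =>
        (ENNReal.ofReal (k x)).toReal • Complex.exp (t * x * Complex.I) := by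
      intro k hk
      have hc : Continuous fun x : ℝ => Complex.exp (t * x * Complex.I) := by fun_prop
      have hm' : AEStronglyMeasurable (fun x => (ENNReal.ofReal (k x)).toReal) volume :=
        hk.aestronglyMeasurable.aemeasurable.ennreal_ofReal.ennreal_toReal.aestronglyMeasurable
      refine hk.mono (hm'.smul hc.aestronglyMeasurable) (Eventually.of_forall fun x => ?_)
      rw [norm_smul, hexp, mul_one, ENNReal.toReal_ofReal', Real.norm_of_nonneg (le_max_right _ _)]
      exact max_le (le_abs_self _) (abs_nonneg _)
    rw [← integral_sub (hi g hg) (hi (fun x => -g x) hg.neg), ← h t]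
    refine integral_congr_ae (Eventually.of_forall fun x => ?_)
    simp only [← sub_smul]
    rw [Complex.real_smul, ENNReal.toReal_ofReal', ENNReal.toReal_ofReal',
      max_zero_sub_max_neg_zero_eq_self]
  rw [withDensity_eq_iff e1 e2 hg.lintegral_lt_top.ne] at key
  filter_upwards [key] with x hx
  have h1 := congrArg ENNReal.toReal hx
  rw [ENNReal.toReal_ofReal', ENNReal.toReal_ofReal'] at h1
  have := max_zero_sub_max_neg_zero_eq_self (g x)
  rw [h1, sub_self] at this
  exact this.symm

/-- Completing the square gives `c |x| ≤ c² / (2a) + (a / 2) x²`, so half of the Gaussian absorbs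
the exponential. -/
lemma memLp_exp_mul_gauss {a : ℝ} (ha : 0 < a) (c : ℝ) :
    MemLp (fun x : ℝ => Real.exp (c * |x|) * Real.exp (-a * x ^ 2)) 2 := by
  have h := memLp_polyGauss (a := a / 2) (by positivity) (C (Real.exp (c ^ 2 / (2 * a))))
  refine h.mono (Continuous.aestronglyMeasurable (by fun_prop)) (Eventually.of_forall fun x => ?_)
  rw [← Real.exp_add, Real.norm_of_nonneg (Real.exp_nonneg _), polyGauss, eval_C, ← Real.exp_add,
    Real.norm_of_nonneg (Real.exp_nonneg _)]
  apply Real.exp_le_exp.2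
  have h1 : 0 ≤ (c - a * |x|) ^ 2 / (2 * a) := by positivity
  have h2 : (c - a * |x|) ^ 2 / (2 * a) = c ^ 2 / (2 * a) - c * |x| + a / 2 * x ^ 2 := by
    rw [← sq_abs x]; field_simp; ring
  linarith

/-- Expanding `exp(itx)` writes the Fourier transform of `exp(-a x²) f` as a series of vanishing
moments. The exchange of sum and integral is dominated by `exp(|t| |x|) exp(-a x²) |f|`. -/
lemma ae_eq_zero_of_moments {a : ℝ} (ha : 0 < a) {f : ℝ → ℝ} (hf : MemLp f 2)
    (h : ∀ n : ℕ, ∫ x, polyGauss a (X ^ n) x * f x = 0) : f =ᵐ[volume] 0 := by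
  have hi : ∀ c : ℝ, Integrable fun x => Real.exp (c * |x|) * Real.exp (-a * x ^ 2) * f x :=
    fun c => (memLp_exp_mul_gauss ha c).integrable_mul hf
  have hg : Integrable fun x => Real.exp (-a * x ^ 2) * f x := by simpa using hi 0
  have h0 := ae_eq_zero_of_integral_exp hg fun t => by
    have hs : ∀ x : ℝ, HasSum (fun n : ℕ => ((Real.exp (-a * x ^ 2) * f x : ℝ) : ℂ) *
        ((t * x * Complex.I) ^ n / n.factorial))
        (((Real.exp (-a * x ^ 2) * f x : ℝ) : ℂ) * Complex.exp (t * x * Complex.I)) := by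
      intro x
      have := NormedSpace.expSeries_div_hasSum_exp (t * x * Complex.I)
      rw [← Complex.exp_eq_exp_ℂ] at this
      exact this.mul_left _
    have hs2 : ∀ x : ℝ, HasSum (fun n : ℕ => |Real.exp (-a * x ^ 2) * f x| *
        ((|t| * |x|) ^ n / n.factorial))
        (|Real.exp (-a * x ^ 2) * f x| * Real.exp (|t| * |x|)) := by
      intro x
      have := NormedSpace.expSeries_div_hasSum_exp (|t| * |x|)
      rw [← Real.exp_eq_exp_ℝ] at this
      exact this.mul_left _
    have hsum := hasSum_integral_of_dominated_convergence (μ := (volume : Measure ℝ))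
      (F := fun (n : ℕ) (x : ℝ) => ((Real.exp (-a * x ^ 2) * f x : ℝ) : ℂ) *
        ((t * x * Complex.I) ^ n / n.factorial))
      (f := fun x : ℝ => ((Real.exp (-a * x ^ 2) * f x : ℝ) : ℂ) * Complex.exp (t * x * Complex.I))
      (fun n x => |Real.exp (-a * x ^ 2) * f x| * ((|t| * |x|) ^ n / n.factorial))
      (fun n => by
        refine AEStronglyMeasurable.mul ?_ (Continuous.aestronglyMeasurable (by fun_prop))
        exact hg.ofReal.aestronglyMeasurable)
      (fun n => Eventually.of_forall fun x => by
        rw [norm_mul, Complex.norm_real, Real.norm_eq_abs]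
        simp)
      (Eventually.of_forall fun x => (hs2 x).summable)
      (by
        refine (hi |t|).abs.congr (Eventually.of_forall fun x => ?_)
        simp only [(hs2 x).tsum_eq]
        rw [mul_assoc, abs_mul, abs_of_pos (Real.exp_pos _), mul_comm])
      (Eventually.of_forall hs)
    refine hsum.unique ?_
    have hz : ∀ n : ℕ, ∫ x : ℝ, ((Real.exp (-a * x ^ 2) * f x : ℝ) : ℂ) *
        ((t * x * Complex.I) ^ n / n.factorial) = 0 := by
      intro n
      have : ∀ x : ℝ, ((Real.exp (-a * x ^ 2) * f x : ℝ) : ℂ) *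
        ((t * x * Complex.I) ^ n / n.factorial) =
          ((t * Complex.I) ^ n / n.factorial) * ((polyGauss a (X ^ n) x * f x : ℝ) : ℂ) := by
        intro x
        simp only [polyGauss, eval_pow, eval_X]
        push_cast; ring
      simp only [this]
      rw [integral_const_mul, integral_complex_ofReal, h n]
      simp
    simp only [hz]
    exact hasSum_zero
  filter_upwards [h0] with x hx
  exact (mul_eq_zero.1 hx).resolve_left (Real.exp_pos _).ne'

lemma oscPoly_degree {s : ℝ} (hs : 0 < s) (n : ℕ) : (oscPoly s n).degree = n := by
  have h1 : (hermiteReal n).natDegree = n := by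
    rw [hermiteReal, (hermite_monic n).natDegree_map, natDegree_hermite]
  have h2 : hermiteReal n ≠ 0 := ((hermite_monic n).map _).ne_zero
  have hc : √s / √(√Real.pi * n.factorial) ≠ 0 := by positivity
  have hc2 : √2 * s ≠ 0 := by positivity
  have h3 : ((hermiteReal n).comp (C (√2 * s) * X)).natDegree = n := by
    rw [natDegree_comp, h1, natDegree_C_mul_X _ hc2, mul_one]
  have h4 : (hermiteReal n).comp (C (√2 * s) * X) ≠ 0 := by
    rcases Nat.eq_zero_or_pos n with rfl | hn
    · simp [hermiteReal]
    · intro h0; rw [h0, natDegree_zero] at h3; omega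
  rw [oscPoly, degree_C_mul hc, degree_eq_natDegree h4, h3]

lemma ae_eq_zero_of_osc {s : ℝ} (hs : 0 < s) {f : ℝ → ℝ} (hf : MemLp f 2)
    (h : ∀ n : ℕ, ∫ x, osc s n x * f x = 0) : f =ᵐ[volume] 0 := by
  have ha : 0 < s ^ 2 / 2 := by positivity
  refine ae_eq_zero_of_moments ha hf fun n => ?_
  -- One polynomial of each degree spans all polynomials, so orthogonality to every `osc s n` yields
  -- the vanishing of all moments.
  let S : Polynomial.Sequence ℝ := ⟨oscPoly s, oscPoly_degree hs⟩
  have hspan : Submodule.span ℝ (Set.range (oscPoly s)) = ⊤ := S.span fun i =>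
    (leadingCoeff_ne_zero.2 (S.ne_zero i)).isUnit
  have hmem : (X ^ n : ℝ[X]) ∈ Submodule.span ℝ (Set.range (oscPoly s)) := hspan ▸ trivial
  have hint : ∀ P, Integrable fun x => polyGauss (s ^ 2 / 2) P x * f x := fun P =>
    (memLp_polyGauss ha P).integrable_mul hf
  generalize (X ^ n : ℝ[X]) = P at hmem
  induction hmem using Submodule.span_induction with
  | mem P hP =>
    obtain ⟨m, rfl⟩ := hP
    rw [← osc_eq_polyGauss]; exact h m
  | zero => simp [polyGauss]
  | add P Q _ _ hP hQ =>
    have : ∀ x, polyGauss (s ^ 2 / 2) (P + Q) x * f x =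
        polyGauss (s ^ 2 / 2) P x * f x + polyGauss (s ^ 2 / 2) Q x * f x := fun x => by
      simp only [polyGauss, eval_add]; ring
    simp only [this]
    rw [integral_add (hint P) (hint Q), hP, hQ, add_zero]
  | smul c P _ hP =>
    have : ∀ x, polyGauss (s ^ 2 / 2) (c • P) x * f x = c * (polyGauss (s ^ 2 / 2) P x * f x) :=
      fun x => by simp only [polyGauss, eval_smul, smul_eq_mul]; ring
    simp only [this]
    rw [integral_const_mul, hP, mul_zero]

lemma memLp_osc_complex {s : ℝ} (hs : 0 < s) (n : ℕ) : MemLp (fun x => (osc s n x : ℂ)) 2 :=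
  (memLp_osc hs n).ofReal

/-- The normalized eigenfunctions of `-d²/dx² + s⁴ x²` as vectors. -/
def oscVec {s : ℝ} (hs : 0 < s) (n : ℕ) : Lp ℂ 2 (volume : Measure ℝ) :=
  (memLp_osc_complex hs n).toLp _

lemma coeFn_oscVec {s : ℝ} (hs : 0 < s) (n : ℕ) :
    oscVec hs n =ᵐ[volume] fun x => (osc s n x : ℂ) := MemLp.coeFn_toLp _

lemma inner_oscVec {s : ℝ} (hs : 0 < s) (n : ℕ) {u : Lp ℂ 2 (volume : Measure ℝ)} {f : ℝ → ℂ}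
    (hu : u =ᵐ[volume] f) : ⟪oscVec hs n, u⟫_ℂ = ∫ x, (osc s n x : ℂ) * f x := by
  rw [L2.inner_def]
  refine integral_congr_ae ?_
  filter_upwards [coeFn_oscVec hs n, hu] with x h1 h2
  rw [h1, h2, RCLike.inner_apply, Complex.conj_ofReal, mul_comm]

lemma orthonormal_oscVec {s : ℝ} (hs : 0 < s) : Orthonormal ℂ (oscVec hs) := by
  rw [orthonormal_iff_ite]
  intro n m
  rw [inner_oscVec hs n (coeFn_oscVec hs m)]
  have : ∀ x, (osc s n x : ℂ) * (osc s m x : ℂ) = ((osc s n x * osc s m x : ℝ) : ℂ) := fun x => by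
    push_cast; rfl
  simp only [this]
  rw [integral_complex_ofReal]
  split_ifs with h
  · subst h; rw [integral_osc_sq hs]; rfl
  · rw [integral_osc_mul_osc hs h]; rfl

/-- The Hilbert basis of the eigenfunctions of `-d²/dx² + s⁴ x²`. -/
def oscBasis {s : ℝ} (hs : 0 < s) : HilbertBasis ℕ ℂ (Lp ℂ 2 (volume : Measure ℝ)) :=
  HilbertBasis.mkOfOrthogonalEqBot (orthonormal_oscVec hs) <| by
    rw [Submodule.eq_bot_iff]
    intro u hu
    have h : ∀ n, ∫ x, (osc s n x : ℂ) * u x = 0 := fun n => by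
      rw [← inner_oscVec hs n (EventuallyEq.refl _ _)]
      exact Submodule.inner_right_of_mem_orthogonal
        (Submodule.subset_span (Set.mem_range_self n)) hu
    have hint : ∀ n, Integrable fun x => (osc s n x : ℂ) * u x := fun n =>
      (memLp_osc_complex hs n).integrable_mul (Lp.memLp u)
    have hre := ae_eq_zero_of_osc hs (Lp.memLp u).re fun n => by
      have h1 := integral_re (hint n)
      rw [h n] at h1
      simpa using h1
    have him := ae_eq_zero_of_osc hs (Lp.memLp u).im fun n => by
      have h1 := integral_im (hint n)
      rw [h n] at h1
      simpa using h1
    refine Lp.ext ?_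
    filter_upwards [hre, him, Lp.coeFn_zero ℂ 2 (volume : Measure ℝ)] with x h1 h2 h3
    rw [h3]
    exact Complex.ext h1 h2

@[simp] lemma oscBasis_apply {s : ℝ} (hs : 0 < s) (n : ℕ) : oscBasis hs n = oscVec hs n := by
  rw [oscBasis, HilbertBasis.coe_mkOfOrthogonalEqBot]

end Complete

end EdgePotential

namespace EdgePotential

open scoped InnerProductSpace Topology BoundedContinuousFunction
open Filter

/-! ### Multiplication operators and their dependence on translation -/

section Multiplication

lemma memLp_mul (V : ℝ →ᵇ ℝ) (u : Lp ℂ 2 (volume : Measure ℝ)) :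
    MemLp (fun x => (V x : ℂ) * u x) 2 := by
  refine MemLp.of_le_mul (c := ‖V‖) (Lp.memLp u) ?_ (Eventually.of_forall fun x => ?_)
  · exact (Complex.continuous_ofReal.comp V.continuous).aestronglyMeasurable.mul
      (Lp.aestronglyMeasurable u)
  · rw [norm_mul, Complex.norm_real]
    gcongr
    exact V.norm_coe_le_norm x

/-- Multiplication by a bounded continuous function. -/
def mulOp (V : ℝ →ᵇ ℝ) : Lp ℂ 2 (volume : Measure ℝ) →L[ℂ] Lp ℂ 2 (volume : Measure ℝ) :=
  LinearMap.mkContinuous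
    { toFun := fun u => (memLp_mul V u).toLp _
      map_add' := fun u v => by
        refine Lp.ext ?_
        filter_upwards [(memLp_mul V (u + v)).coeFn_toLp, (memLp_mul V u).coeFn_toLp,
          (memLp_mul V v).coeFn_toLp, Lp.coeFn_add u v,
          Lp.coeFn_add ((memLp_mul V u).toLp _) ((memLp_mul V v).toLp _)] with x h1 h2 h3 h4 h5
        rw [h1, h5, Pi.add_apply, h2, h3, h4, Pi.add_apply, mul_add]
      map_smul' := fun c u => by
        refine Lp.ext ?_
        filter_upwards [(memLp_mul V (c • u)).coeFn_toLp, (memLp_mul V u).coeFn_toLp,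
          Lp.coeFn_smul c u, Lp.coeFn_smul c ((memLp_mul V u).toLp _)] with x h1 h2 h3 h4
        rw [h1, RingHom.id_apply, h4, Pi.smul_apply, h2, h3, Pi.smul_apply]
        exact mul_left_comm _ _ _ }
    ‖V‖ fun u => by
      refine Lp.norm_le_mul_norm_of_ae_le_mul ?_
      filter_upwards [(memLp_mul V u).coeFn_toLp] with x h1
      change ‖((memLp_mul V u).toLp _ : Lp ℂ 2 (volume : Measure ℝ)) x‖ ≤ _
      rw [h1, norm_mul, Complex.norm_real]
      gcongr
      exact V.norm_coe_le_norm x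

lemma coeFn_mulOp (V : ℝ →ᵇ ℝ) (u : Lp ℂ 2 (volume : Measure ℝ)) :
    mulOp V u =ᵐ[volume] fun x => (V x : ℂ) * u x := (memLp_mul V u).coeFn_toLp

lemma norm_mulOp_le (V : ℝ →ᵇ ℝ) : ‖mulOp V‖ ≤ ‖V‖ :=
  LinearMap.mkContinuous_norm_le _ (norm_nonneg _) _

lemma isSymmBdd_mulOp {V : ℝ →ᵇ ℝ} {w : ℝ} (hw : 0 ≤ w) (hV : ∀ x, |V x| ≤ w) :
    IsSymmBdd (mulOp V) w where
  symm u v := by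
    rw [L2.inner_def, L2.inner_def]
    refine integral_congr_ae ?_
    filter_upwards [coeFn_mulOp V u, coeFn_mulOp V v] with x h1 h2
    rw [h1, h2, RCLike.inner_apply, RCLike.inner_apply, map_mul, Complex.conj_ofReal]
    ring
  bound u := (ContinuousLinearMap.le_opNorm _ _).trans (by
    gcongr
    exact (norm_mulOp_le V).trans ((BoundedContinuousFunction.norm_le hw).2 hV))

/-- Multiplication operators depend linearly and continuously on the multiplier. -/
def mulOpL : (ℝ →ᵇ ℝ) →L[ℝ]
    (Lp ℂ 2 (volume : Measure ℝ) →L[ℂ] Lp ℂ 2 (volume : Measure ℝ)) :=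
  LinearMap.mkContinuous
    { toFun := mulOp
      map_add' := fun V U => by
        ext1 u
        refine Lp.ext ?_
        filter_upwards [coeFn_mulOp (V + U) u, coeFn_mulOp V u, coeFn_mulOp U u,
          Lp.coeFn_add (mulOp V u) (mulOp U u)] with x h1 h2 h3 h4
        rw [add_apply, h1, h4, Pi.add_apply, h2, h3, BoundedContinuousFunction.add_apply]
        push_cast; ring
      map_smul' := fun c V => by
        ext1 u
        refine Lp.ext ?_
        filter_upwards [coeFn_mulOp (c • V) u, coeFn_mulOp V u,
          Lp.coeFn_smul c (mulOp V u)] with x h1 h2 h3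
        rw [RingHom.id_apply, smul_apply, h1, h3, Pi.smul_apply, h2,
          BoundedContinuousFunction.smul_apply, Complex.real_smul, smul_eq_mul]
        push_cast; ring }
    1 fun V => by rw [one_mul]; exact norm_mulOp_le V

/-- The translate of a bounded continuous function. -/
def translate (f : ℝ → ℝ) (hf : Continuous f) {C : ℝ} (hC : ∀ x, |f x| ≤ C) (t : ℝ) : ℝ →ᵇ ℝ :=
  BoundedContinuousFunction.ofNormedAddCommGroup (fun x => f (x + t)) (by fun_prop) C
    fun x => hC (x + t)

@[simp] lemma translate_apply (f : ℝ → ℝ) (hf : Continuous f) {C : ℝ} (hC : ∀ x, |f x| ≤ C)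
    (t x : ℝ) : translate f hf hC t x = f (x + t) := rfl

lemma abs_sub_le_of_hasDerivAt {f f' : ℝ → ℝ} (hf : ∀ x, HasDerivAt f (f' x) x) {C : ℝ}
    (hC : ∀ x, |f' x| ≤ C) (x y : ℝ) : |f y - f x| ≤ C * |y - x| :=
  Convex.norm_image_sub_le_of_norm_hasDerivWithin_le (s := Set.univ)
    (fun x _ => (hf x).hasDerivWithinAt) (fun x _ => hC x) convex_univ trivial trivial

lemma abs_sub_sub_le_of_hasDerivAt {f f' f'' : ℝ → ℝ} (hf : ∀ x, HasDerivAt f (f' x) x)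
    (hf' : ∀ x, HasDerivAt f' (f'' x) x) {C : ℝ} (hC : ∀ x, |f'' x| ≤ C) (x y : ℝ) :
    |f y - f x - (y - x) * f' x| ≤ C * |y - x| ^ 2 := by
  have hC0 : 0 ≤ C := (abs_nonneg _).trans (hC 0)
  have h := Convex.norm_image_sub_le_of_norm_hasDerivWithin_le (s := Set.uIcc x y)
    (f := fun z => f z - z * f' x) (f' := fun z => f' z - 1 * f' x) (C := C * |y - x|)
    (fun z _ => ((hf z).sub ((hasDerivAt_id z).mul_const _)).hasDerivWithinAt)
    (fun z hz => by
      rw [one_mul]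
      refine (abs_sub_le_of_hasDerivAt hf' hC x z).trans ?_
      exact mul_le_mul_of_nonneg_left (Set.abs_sub_left_of_mem_uIcc hz) hC0)
    (convex_uIcc x y) Set.left_mem_uIcc Set.right_mem_uIcc
  rw [Real.norm_eq_abs, Real.norm_eq_abs] at h
  calc _ = |f y - y * f' x - (f x - x * f' x)| := by congr 1; ring
    _ ≤ _ := h.trans_eq (by ring)

/-- The first-order Taylor remainder is at most `C'' (s - t)²` uniformly in `x`, so the derivative
exists in the sup norm; `mulOpL` carries it to the operator norm. -/
lemma hasDerivAt_translate {f f' f'' : ℝ → ℝ} (hfc : Continuous f) (hfc' : Continuous f')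
    (hf : ∀ x, HasDerivAt f (f' x) x) (hf' : ∀ x, HasDerivAt f' (f'' x) x) {C C' C'' : ℝ}
    (hC : ∀ x, |f x| ≤ C) (hC' : ∀ x, |f' x| ≤ C') (hC'' : ∀ x, |f'' x| ≤ C'') (t : ℝ) :
    HasDerivAt (translate f hfc hC) (translate f' hfc' hC' t) t := by
  rw [hasDerivAt_iff_isLittleO]
  have h1 : (fun s => translate f hfc hC s - translate f hfc hC t -
      (s - t) • translate f' hfc' hC' t) =O[𝓝 t] fun s => (s - t) ^ 2 := by
    refine Asymptotics.IsBigO.of_bound C'' (Eventually.of_forall fun s => ?_)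
    have hC0 : 0 ≤ C'' := (abs_nonneg _).trans (hC'' 0)
    refine (BoundedContinuousFunction.norm_le (by positivity)).2 fun x => ?_
    have := abs_sub_sub_le_of_hasDerivAt hf hf' hC'' (x + t) (x + s)
    rw [show x + s - (x + t) = s - t by ring] at this
    simpa using this
  refine h1.trans_isLittleO ?_
  have h2 := (Asymptotics.isLittleO_pow_id (𝕜 := ℝ) (n := 2) (by norm_num)).comp_tendsto
    (k := fun s : ℝ => s - t) (l' := 𝓝 t) (by
      have : Continuous fun s : ℝ => s - t := by fun_prop
      simpa using this.tendsto t)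
  exact h2

lemma continuous_translate {f f' : ℝ → ℝ} (hfc : Continuous f)
    (hf : ∀ x, HasDerivAt f (f' x) x) {C C' : ℝ}
    (hC : ∀ x, |f x| ≤ C) (hC' : ∀ x, |f' x| ≤ C') : Continuous (translate f hfc hC) := by
  have hC0 : 0 ≤ C' := (abs_nonneg _).trans (hC' 0)
  refine (LipschitzWith.of_dist_le_mul (K := ⟨C', hC0⟩) fun s t => ?_).continuous
  refine (BoundedContinuousFunction.dist_le (by positivity)).2 fun x => ?_
  have := abs_sub_le_of_hasDerivAt hf hC' (x + t) (x + s)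
  rw [show x + s - (x + t) = s - t by ring] at this
  exact this

end Multiplication

/-! ### Translation to `k = 0` -/

section Translation

variable {b : ℝ} {W : ℝ → ℝ} {k : ℝ}

/-- Translation by `t` in `L²(ℝ)`. -/
def translateLp (t : ℝ) : Lp ℂ 2 (volume : Measure ℝ) →ₗᵢ[ℂ] Lp ℂ 2 (volume : Measure ℝ) :=
  Lp.compMeasurePreservingₗᵢ ℂ (fun x => x + t) (measurePreserving_add_right volume t)

lemma coeFn_translateLp (t : ℝ) {u : Lp ℂ 2 (volume : Measure ℝ)} {f : ℝ → ℂ}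
    (hu : u =ᵐ[volume] f) : translateLp t u =ᵐ[volume] fun x => f (x + t) :=
  (Lp.coeFn_compMeasurePreserving u (measurePreserving_add_right volume t)).trans
    ((measurePreserving_add_right volume t).quasiMeasurePreserving.ae_eq_comp hu)

lemma translateLp_mem_coreGraph (t : ℝ)
    {p : Lp ℂ 2 (volume : Measure ℝ) × Lp ℂ 2 (volume : Measure ℝ)} (hp : p ∈ coreGraph b W k) :
    (translateLp t p.1, translateLp t p.2) ∈ coreGraph b (fun x => W (x + t)) (k - b * t) := by
  obtain ⟨f, hf, hfc, h1, h2⟩ := hp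
  refine ⟨fun x => f (x + t), hf.comp (contDiff_id.add contDiff_const),
    hfc.comp_homeomorph (Homeomorph.addRight t), coeFn_translateLp t h1, ?_⟩
  refine (coeFn_translateLp t h2).trans (Eventually.of_forall fun x => ?_)
  simp only [fiberExpr, iteratedDeriv_comp_add_const]
  rw [show b * x - (k - b * t) = b * (x + t) - k by ring]

lemma translateLp_mem_fiberGraph (t : ℝ)
    {p : Lp ℂ 2 (volume : Measure ℝ) × Lp ℂ 2 (volume : Measure ℝ)} (hp : p ∈ fiberGraph b W k) :
    (translateLp t p.1, translateLp t p.2) ∈ fiberGraph b (fun x => W (x + t)) (k - b * t) := by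
  have hc : Continuous fun p : Lp ℂ 2 (volume : Measure ℝ) × Lp ℂ 2 (volume : Measure ℝ) =>
      (translateLp t p.1, translateLp t p.2) := by
    have := (translateLp t).continuous
    fun_prop
  exact map_mem_closure (f := fun p : Lp ℂ 2 (volume : Measure ℝ) × Lp ℂ 2 (volume : Measure ℝ) =>
    (translateLp t p.1, translateLp t p.2)) hc hp fun q hq => translateLp_mem_coreGraph t hq

lemma eigenvalues_subset_translate (t : ℝ) :
    eigenvalues b W k ⊆ eigenvalues b (fun x => W (x + t)) (k - b * t) := by
  rintro μ ⟨u, hu, h⟩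
  refine ⟨translateLp t u, fun h0 => hu ?_, ?_⟩
  · exact (translateLp t).injective (h0.trans (map_zero _).symm)
  · have := translateLp_mem_fiberGraph t h
    rwa [map_smul] at this

lemma eigenvalues_translate (hb : b ≠ 0) :
    eigenvalues b W k = eigenvalues b (fun x => W (x + k / b)) 0 := by
  have h0 : k - b * (k / b) = 0 := by field_simp; ring
  refine Set.Subset.antisymm ?_ ?_
  · have := eigenvalues_subset_translate (b := b) (W := W) (k := k) (k / b)
    rwa [h0] at this
  · have := eigenvalues_subset_translate (b := b) (W := fun x => W (x + k / b)) (k := 0) (-(k / b))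
    have h1 : 0 - b * -(k / b) = k := by field_simp; ring
    rw [h1] at this
    simpa using this

end Translation

end EdgePotential

namespace EdgePotential

open scoped InnerProductSpace Topology BoundedContinuousFunction
open Filter Polynomial

/-! ### The closed operator in the Hermite basis -/

section Oscillator

variable {b : ℝ}

lemma sqrt_pow_four (hb : 0 < b) : √b ^ 4 = b ^ 2 := by
  rw [show 4 = 2 * 2 by norm_num, pow_mul, Real.sq_sqrt hb.le]

/-- Green's identity: `osc' f - osc f'` has compact support, so its derivative integrates to zero.
-/
lemma integral_osc_mul_fiberExpr (hb : 0 < b) {V : ℝ → ℝ} (n : ℕ) {f : ℝ → ℂ} (hf : ContDiff ℝ ∞ f)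
    (hfc : HasCompactSupport f) :
    ∫ x, (osc (√b) n x : ℂ) * (fiberExpr b V 0 f x - V x * f x) =
      ∫ x, (osc (√b) n x : ℂ) * (((2 * n + 1) * b : ℝ) * f x) := by
  have hd : ∀ x, HasDerivAt f (deriv f x) x := fun x =>
    (hf.differentiable (by simp)).differentiableAt.hasDerivAt
  have hf1 : ContDiff ℝ ∞ (deriv f) := (contDiff_infty_iff_deriv.1 hf).2
  have hd2 : ∀ x, HasDerivAt (deriv f) (iteratedDeriv 2 f x) x := fun x => by
    have := (hf1.differentiable (by simp) x).hasDerivAt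
    rwa [iteratedDeriv_succ, iteratedDeriv_one]
  have hf2 : Continuous (iteratedDeriv 2 f) :=
    (contDiff_infty.1 hf 2).continuous_iteratedDeriv 2 le_rfl
  have ho : Continuous fun x => (osc (√b) n x : ℂ) :=
    Complex.continuous_ofReal.comp (contDiff_osc _ _).continuous
  have ho1 : Continuous fun x => (oscDeriv (√b) n x : ℂ) :=
    Complex.continuous_ofReal.comp (continuous_polyGauss _ _)
  have hc1 : HasCompactSupport (deriv f) := hfc.deriv
  have hc2 : HasCompactSupport (iteratedDeriv 2 f) := by
    rw [iteratedDeriv_succ, iteratedDeriv_one]; exact hc1.deriv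
  have i1 : Integrable fun x => (osc (√b) n x : ℂ) * iteratedDeriv 2 f x :=
    (ho.mul hf2).integrable_of_hasCompactSupport hc2.mul_left
  have i2 : Integrable fun x =>
      ((b ^ 2 * x ^ 2 - (2 * n + 1) * b : ℝ) : ℂ) * osc (√b) n x * f x := by
    refine Continuous.integrable_of_hasCompactSupport ?_ hfc.mul_left
    have := hf.continuous
    fun_prop
  have i3 : Integrable fun x => (osc (√b) n x : ℂ) * (((2 * n + 1) * b : ℝ) * f x) :=
    Continuous.integrable_of_hasCompactSupport (by have := hf.continuous; fun_prop)
      hfc.mul_left.mul_left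
  have h0 := integral_eq_zero_of_hasDerivAt_of_integrable
    (f := fun x => (oscDeriv (√b) n x : ℂ) * f x - osc (√b) n x * deriv f x)
    (f' := fun x => ((b ^ 2 * x ^ 2 - (2 * n + 1) * b : ℝ) : ℂ) * osc (√b) n x * f x -
      osc (√b) n x * iteratedDeriv 2 f x)
    (fun x => by
      have e1 := (hasDerivAt_osc (√b) n x).ofReal_comp
      have e2 := (hasDerivAt_oscDeriv (√b) n x).ofReal_comp
      refine ((e2.mul (hd x)).sub (e1.mul (hd2 x))).congr_deriv ?_
      rw [sqrt_pow_four hb, Real.sq_sqrt hb.le]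
      push_cast; ring)
    (i2.sub i1)
    (((ho1.mul hf.continuous).integrable_of_hasCompactSupport hfc.mul_left).sub
      ((ho.mul hf1.continuous).integrable_of_hasCompactSupport hc1.mul_left))
  have h1 : ∀ x, (osc (√b) n x : ℂ) * (fiberExpr b V 0 f x - V x * f x) =
      (((b ^ 2 * x ^ 2 - (2 * n + 1) * b : ℝ) : ℂ) * osc (√b) n x * f x -
        osc (√b) n x * iteratedDeriv 2 f x) +
      (osc (√b) n x : ℂ) * (((2 * n + 1) * b : ℝ) * f x) := by
    intro x
    simp only [fiberExpr]
    push_cast; ring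
  simp only [h1]
  exact (integral_add (i2.sub i1) i3).trans ((congrArg (· + _) h0).trans (zero_add _))

/-- The eigenvector equations hold on the whole graph. -/
lemma inner_of_mem_fiberGraph (hb : 0 < b) (V : ℝ →ᵇ ℝ)
    {p : Lp ℂ 2 (volume : Measure ℝ) × Lp ℂ 2 (volume : Measure ℝ)} (hp : p ∈ fiberGraph b V 0)
    (n : ℕ) :
    ⟪oscVec (Real.sqrt_pos.2 hb) n, p.2 - mulOp V p.1⟫_ℂ =
      (((2 * n + 1) * b : ℝ) : ℂ) * ⟪oscVec (Real.sqrt_pos.2 hb) n, p.1⟫_ℂ := by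
  have hclosed : IsClosed {p : Lp ℂ 2 (volume : Measure ℝ) × Lp ℂ 2 (volume : Measure ℝ) |
      ⟪oscVec (Real.sqrt_pos.2 hb) n, p.2 - mulOp V p.1⟫_ℂ =
      (((2 * n + 1) * b : ℝ) : ℂ) * ⟪oscVec (Real.sqrt_pos.2 hb) n, p.1⟫_ℂ} :=
    isClosed_eq (by fun_prop) (by fun_prop)
  refine closure_minimal ?_ hclosed hp
  rintro q ⟨f, hf, hfc, h1, h2⟩
  have h3 : (q.2 - mulOp V q.1 : Lp ℂ 2 (volume : Measure ℝ)) =ᵐ[volume]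
      fun x => fiberExpr b V 0 f x - V x * f x := by
    filter_upwards [Lp.coeFn_sub q.2 (mulOp V q.1), coeFn_mulOp V q.1, h1, h2] with x e1 e2 e3 e4
    rw [e1, Pi.sub_apply, e2, e3, e4]
  have h4 : ((((2 * n + 1) * b : ℝ) : ℂ) • q.1 : Lp ℂ 2 (volume : Measure ℝ)) =ᵐ[volume]
      fun x => (((2 * n + 1) * b : ℝ) : ℂ) * f x := by
    filter_upwards [Lp.coeFn_smul (((2 * n + 1) * b : ℝ) : ℂ) q.1, h1] with x e1 e2
    rw [e1, Pi.smul_apply, e2, smul_eq_mul]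
  change ⟪_, _⟫_ℂ = _ * ⟪_, _⟫_ℂ
  rw [← inner_smul_right, inner_oscVec _ n h3, inner_oscVec _ n h4]
  exact integral_osc_mul_fiberExpr hb n hf hfc

/-- The bump is `1` on `[-1, 1]`, and elsewhere the error is at most `1 < |x|`. The linear bound
gives `|χ(δx) o(x) - o(x)| ≤ δ |x o(x)|`, an explicit rate in `L²`. -/
lemma exists_cutoff : ∃ χ : ℝ → ℝ, ContDiff ℝ ∞ χ ∧ HasCompactSupport χ ∧
    ∀ x, |χ x - 1| ≤ |x| := by
  let χ : ContDiffBump (0 : ℝ) := ⟨1, 2, by norm_num, by norm_num⟩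
  refine ⟨χ, χ.contDiff, χ.hasCompactSupport, fun x => ?_⟩
  · rcases le_or_gt |x| 1 with h | h
    · rw [χ.one_of_mem_closedBall (by simpa [χ] using h)]; simp
    · have h1 := χ.nonneg' x
      have h2 := χ.le_one (x := x)
      rw [abs_le]; constructor <;> linarith

lemma exists_abs_le_of_hasCompactSupport {f : ℝ → ℝ} (hf : Continuous f)
    (hc : HasCompactSupport f) : ∃ C, 0 ≤ C ∧ ∀ x, |f x| ≤ C := by
  obtain ⟨C, hC⟩ := hc.exists_bound_of_continuous hf
  exact ⟨C, (norm_nonneg _).trans (hC 0), hC⟩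

lemma tendsto_toLp_zero {g : ℕ → ℝ → ℂ} (hg : ∀ n, MemLp (g n) 2) {h : ℝ → ℝ} (hh : MemLp h 2)
    (hle : ∀ n x, ‖g n x‖ ≤ 1 / ((n : ℝ) + 1) * ‖h x‖) :
    Tendsto (fun n => (hg n).toLp (g n)) atTop (𝓝 0) := by
  refine squeeze_zero_norm (a := fun n : ℕ => 1 / ((n : ℝ) + 1) * ‖hh.toLp h‖) (fun n => ?_) ?_
  · refine Lp.norm_le_mul_norm_of_ae_le_mul ?_
    filter_upwards [(hg n).coeFn_toLp, hh.coeFn_toLp] with x h1 h2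
    rw [h1, h2]; exact hle n x
  · simpa using tendsto_one_div_add_atTop_nhds_zero_nat.mul_const ‖hh.toLp h‖

lemma memLp_id_mul_osc {s : ℝ} (hs : 0 < s) (m : ℕ) : MemLp (fun x => x * osc s m x) 2 := by
  have : (fun x => x * osc s m x) = polyGauss (s ^ 2 / 2) (X * oscPoly s m) := by
    funext x
    rw [osc_eq_polyGauss]
    simp only [polyGauss, eval_mul, eval_X]; ring
  rw [this]
  exact memLp_polyGauss (by positivity) _

/-- Truncations `χ(δₙ x) o(x)` lie in the core, and the operator maps them to the expected image up
to a commutator with the cutoff, of order `δₙ` in `L²`. -/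
lemma oscVec_mem_fiberGraph (hb : 0 < b) (V : ℝ →ᵇ ℝ) (m : ℕ) :
    (oscVec (Real.sqrt_pos.2 hb) m, (((2 * m + 1) * b : ℝ) : ℂ) • oscVec (Real.sqrt_pos.2 hb) m +
      mulOp V (oscVec (Real.sqrt_pos.2 hb) m)) ∈ fiberGraph b V 0 := by
  obtain ⟨χ, hχ, hχc, hχ2⟩ := exists_cutoff
  have hs := Real.sqrt_pos.2 hb
  set o := osc (√b) m with ho
  set o' := oscDeriv (√b) m with ho'
  have hχ' : ContDiff ℝ ∞ (deriv χ) := (contDiff_infty_iff_deriv.1 hχ).2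
  have hχ'' : ContDiff ℝ ∞ (deriv (deriv χ)) := (contDiff_infty_iff_deriv.1 hχ').2
  obtain ⟨C₁, hC₁, hb₁⟩ := exists_abs_le_of_hasCompactSupport hχ'.continuous hχc.deriv
  obtain ⟨C₂, hC₂, hb₂⟩ := exists_abs_le_of_hasCompactSupport hχ''.continuous hχc.deriv.deriv
  have dχ : ∀ x, HasDerivAt χ (deriv χ x) x := fun x =>
    (hχ.differentiable (by simp) x).hasDerivAt
  have dχ' : ∀ x, HasDerivAt (deriv χ) (deriv (deriv χ) x) x := fun x =>
    (hχ'.differentiable (by simp) x).hasDerivAt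
  have hoc : ContDiff ℝ ∞ o := contDiff_osc _ _
  have hoc' : Continuous o' := continuous_polyGauss _ _
  let δ : ℕ → ℝ := fun n => 1 / ((n : ℝ) + 1)
  have hδ0 : ∀ n, 0 < δ n := fun n => by positivity
  have hδ1 : ∀ n, δ n ≤ 1 := fun n => by
    rw [div_le_one (by positivity)]
    have : (0 : ℝ) ≤ n := n.cast_nonneg
    linarith
  let f : ℕ → ℝ → ℝ := fun n x => χ (δ n * x) * o x
  -- The commutator of `-d²/dx²` with the cutoff, applied to `o`.
  let r : ℕ → ℝ → ℝ := fun n x =>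
    -(δ n ^ 2 * deriv (deriv χ) (δ n * x) * o x + 2 * δ n * deriv χ (δ n * x) * o' x)
  have hfs : ∀ n, ContDiff ℝ ∞ (f n) := fun n =>
    (hχ.comp (contDiff_const.mul contDiff_id)).mul hoc
  have hcs : ∀ {g : ℝ → ℝ}, HasCompactSupport g → ∀ n, HasCompactSupport fun x => g (δ n * x) :=
    fun hg n => hg.comp_homeomorph (Homeomorph.mulLeft₀ (δ n) (hδ0 n).ne')
  have hfc : ∀ n, HasCompactSupport (f n) := fun n => (hcs hχc n).mul_right
  have hrc : ∀ n, Continuous (r n) := fun n => by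
    have := hχ'.continuous
    have := hχ''.continuous
    have := hoc.continuous
    simp only [r]
    fun_prop
  have hd : ∀ n x, HasDerivAt (f n) (δ n * deriv χ (δ n * x) * o x + χ (δ n * x) * o' x) x := by
    intro n x
    have e1 : HasDerivAt (fun x => χ (δ n * x)) (deriv χ (δ n * x) * (δ n * 1)) x :=
      (dχ (δ n * x)).comp x ((hasDerivAt_id x).const_mul (δ n))
    exact (e1.mul (hasDerivAt_osc (√b) m x)).congr_deriv (by ring)
  have hd2 : ∀ n x, HasDerivAt (fun x => δ n * deriv χ (δ n * x) * o x + χ (δ n * x) * o' x)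
      (-r n x + χ (δ n * x) * ((b ^ 2 * x ^ 2 - (2 * m + 1) * b) * o x)) x := by
    intro n x
    have e1 : HasDerivAt (fun x => χ (δ n * x)) (deriv χ (δ n * x) * (δ n * 1)) x :=
      (dχ (δ n * x)).comp x ((hasDerivAt_id x).const_mul (δ n))
    have e2 : HasDerivAt (fun x => deriv χ (δ n * x)) (deriv (deriv χ) (δ n * x) * (δ n * 1)) x :=
      (dχ' (δ n * x)).comp x ((hasDerivAt_id x).const_mul (δ n))
    refine (((e2.const_mul (δ n)).mul (hasDerivAt_osc (√b) m x)).add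
      (e1.mul (hasDerivAt_oscDeriv (√b) m x))).congr_deriv ?_
    rw [sqrt_pow_four hb, Real.sq_sqrt hb.le]
    simp only [r]
    ring
  have hit : ∀ n x, iteratedDeriv 2 (fun x => (f n x : ℂ)) x =
      ((-r n x + χ (δ n * x) * ((b ^ 2 * x ^ 2 - (2 * m + 1) * b) * o x) : ℝ) : ℂ) := by
    intro n x
    have e1 : deriv (fun x => (f n x : ℂ)) =
        fun x => ((δ n * deriv χ (δ n * x) * o x + χ (δ n * x) * o' x : ℝ) : ℂ) :=
      funext fun x => (hd n x).ofReal_comp.deriv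
    rw [iteratedDeriv_succ, iteratedDeriv_one, e1]
    exact (hd2 n x).ofReal_comp.deriv
  have hfm : ∀ n, MemLp (fun x => (f n x : ℂ)) 2 := fun n =>
    ((hfs n).continuous.memLp_of_hasCompactSupport (hfc n)).ofReal
  have hrbound : ∀ n x, |r n x| ≤ δ n * ‖C₂ * |o x| + 2 * C₁ * |o' x|‖ := by
    intro n x
    have hδ := hδ0 n
    have hδ' := hδ1 n
    rw [Real.norm_of_nonneg (by positivity : 0 ≤ C₂ * |o x| + 2 * C₁ * |o' x|)]
    simp only [r]
    rw [abs_neg]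
    refine (abs_add_le _ _).trans ?_
    rw [abs_mul, abs_mul, abs_mul, abs_mul, abs_mul, abs_two, abs_of_pos hδ,
      abs_of_pos (by positivity : 0 < δ n ^ 2)]
    have h1 : δ n ^ 2 ≤ δ n := by nlinarith
    calc _ ≤ δ n * C₂ * |o x| + 2 * δ n * C₁ * |o' x| := by
          gcongr
          · exact hb₂ _
          · exact hb₁ _
      _ = _ := by ring
  have hhm : MemLp (fun x => C₂ * |o x| + 2 * C₁ * |o' x|) 2 :=
    ((memLp_osc hs m).abs.const_mul C₂).add ((memLp_oscDeriv hs m).abs.const_mul (2 * C₁))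
  have hrm : ∀ n, MemLp (fun x => (r n x : ℂ)) 2 := fun n =>
    (hhm.of_le_mul (c := δ n) (hrc n).aestronglyMeasurable
      (Eventually.of_forall fun x => hrbound n x)).ofReal
  have hrt : Tendsto (fun n => (hrm n).toLp _) atTop (𝓝 0) :=
    tendsto_toLp_zero hrm hhm fun n x => by rw [Complex.norm_real]; exact hrbound n x
  have hft : Tendsto (fun n => (hfm n).toLp _) atTop (𝓝 (oscVec hs m)) := by
    rw [tendsto_iff_norm_sub_tendsto_zero]
    have h1 := tendsto_toLp_zero (fun n => (hfm n).sub (memLp_osc_complex hs m))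
      (memLp_id_mul_osc hs m) fun n x => by
        rw [Pi.sub_apply, ← Complex.ofReal_sub, Complex.norm_real, Real.norm_eq_abs]
        change |χ (δ n * x) * o x - o x| ≤ δ n * |x * o x|
        rw [← sub_one_mul, abs_mul, abs_mul, ← mul_assoc]
        gcongr
        refine (hχ2 _).trans_eq ?_
        rw [abs_mul, abs_of_pos (hδ0 n)]
    have h2 := h1.norm
    rw [norm_zero] at h2
    exact h2
  have hcore : ∀ n, ((hfm n).toLp _, (((2 * m + 1) * b : ℝ) : ℂ) • (hfm n).toLp _ +
      mulOp V ((hfm n).toLp _) + (hrm n).toLp _) ∈ coreGraph b V 0 := by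
    intro n
    refine ⟨fun x => (f n x : ℂ), Complex.ofRealCLM.contDiff.comp (hfs n),
      (hfc n).comp_left Complex.ofReal_zero, (hfm n).coeFn_toLp, ?_⟩
    filter_upwards [(hfm n).coeFn_toLp, (hrm n).coeFn_toLp, coeFn_mulOp V ((hfm n).toLp _),
      Lp.coeFn_smul (((2 * m + 1) * b : ℝ) : ℂ) ((hfm n).toLp _),
      Lp.coeFn_add ((((2 * m + 1) * b : ℝ) : ℂ) • (hfm n).toLp _) (mulOp V ((hfm n).toLp _)),
      Lp.coeFn_add ((((2 * m + 1) * b : ℝ) : ℂ) • (hfm n).toLp _ + mulOp V ((hfm n).toLp _))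
        ((hrm n).toLp _)] with x e1 e2 e3 e4 e5 e6
    rw [e6, Pi.add_apply, e5, Pi.add_apply, e4, Pi.smul_apply, e3, e2, e1, fiberExpr, hit,
      smul_eq_mul]
    simp only [f]
    push_cast; ring
  have hlim : Tendsto (fun n => ((hfm n).toLp _, (((2 * m + 1) * b : ℝ) : ℂ) • (hfm n).toLp _ +
      mulOp V ((hfm n).toLp _) + (hrm n).toLp _)) atTop
      (𝓝 (oscVec hs m, (((2 * m + 1) * b : ℝ) : ℂ) • oscVec hs m + mulOp V (oscVec hs m) + 0)) :=
    hft.prodMk_nhds (((hft.const_smul _).add (((mulOp V).continuous.tendsto _).comp hft)).add hrt)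
  rw [add_zero] at hlim
  exact mem_closure_of_tendsto hlim (Eventually.of_forall hcore)

/-- This plays the part of essential self-adjointness. The equations are closed conditions that hold
on the core; conversely they make the expansion of `(u, v)` a sum of multiples of the pairs of
`oscVec_mem_fiberGraph`, and the graph is closed. -/
lemma mem_fiberGraph_iff (hb : 0 < b) (V : ℝ →ᵇ ℝ) (u v : Lp ℂ 2 (volume : Measure ℝ)) :
    (u, v) ∈ fiberGraph b V 0 ↔ ∀ n, ⟪oscVec (Real.sqrt_pos.2 hb) n, v - mulOp V u⟫_ℂ =
      (((2 * n + 1) * b : ℝ) : ℂ) * ⟪oscVec (Real.sqrt_pos.2 hb) n, u⟫_ℂ := by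
  refine ⟨fun h n => inner_of_mem_fiberGraph hb V h n, fun h => ?_⟩
  set e := oscBasis (Real.sqrt_pos.2 hb) with he
  have h1 := e.hasSum_repr u
  have h2 := e.hasSum_repr (v - mulOp V u)
  have h3 : HasSum (fun n => (e.repr u n) • ((oscVec (Real.sqrt_pos.2 hb) n,
      (((2 * n + 1) * b : ℝ) : ℂ) • oscVec (Real.sqrt_pos.2 hb) n +
        mulOp V (oscVec (Real.sqrt_pos.2 hb) n)) :
      Lp ℂ 2 (volume : Measure ℝ) × Lp ℂ 2 (volume : Measure ℝ))) (u, v) := by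
    have h4 := h1.prodMk (h2.add (h1.mapL (mulOp V)))
    rw [sub_add_cancel] at h4
    refine h4.congr_fun fun n => ?_
    simp only [he, oscBasis_apply, HilbertBasis.repr_apply_apply, h n, map_smul, Prod.smul_mk,
      smul_add, smul_smul]
    rw [mul_comm]
  exact (coreGraph b V 0).isClosed_topologicalClosure.mem_of_tendsto h3
    (Eventually.of_forall fun s => (fiberGraph b V 0).sum_mem fun n _ =>
      (fiberGraph b V 0).smul_mem _ (oscVec_mem_fiberGraph hb V n))

lemma eigenvalues_eq_diagEigenvalues (hb : 0 < b) (V : ℝ →ᵇ ℝ) :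
    eigenvalues b V 0 = diagEigenvalues (oscBasis (Real.sqrt_pos.2 hb)) b (mulOp V) := by
  ext μ
  refine exists_congr fun u => and_congr_right fun _ => ?_
  rw [mem_fiberGraph_iff hb]
  refine forall_congr' fun n => ?_
  rw [oscBasis_apply, inner_sub_right, inner_smul_right, Complex.ofReal_sub, sub_mul]
  constructor <;> intro h <;> linear_combination -h

end Oscillator

end EdgePotential

namespace EdgePotential

open scoped InnerProductSpace Topology BoundedContinuousFunction
open Filter

/-! ### Constants, the band function and large `b` -/

section Main

/-- The almost sure bound holds on a dense set, which is closed by continuity. -/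
lemma abs_le_linftyNorm {f : ℝ → ℝ} (hf : Continuous f) (hm : MemLp f ∞ (volume : Measure ℝ))
    (x : ℝ) : |f x| ≤ linftyNorm f := by
  have h1 : ∀ᵐ x, |f x| ≤ linftyNorm f := by
    filter_upwards [ae_le_eLpNormEssSup (f := f) (μ := (volume : Measure ℝ))] with x hx
    rw [← eLpNorm_exponent_top] at hx
    have := ENNReal.toReal_mono hm.2.ne hx
    simpa [linftyNorm] using this
  have h2 : IsClosed {x | |f x| ≤ linftyNorm f} := isClosed_le (by fun_prop) continuous_const
  have h3 : Dense {x | |f x| ≤ linftyNorm f} := Measure.dense_of_ae h1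
  exact Set.eq_univ_iff_forall.1 (h2.closure_eq.symm.trans h3.closure_eq) x

lemma linftyNorm_nonneg (f : ℝ → ℝ) : 0 ≤ linftyNorm f := ENNReal.toReal_nonneg

lemma hasDerivAt_iteratedDeriv {W : ℝ → ℝ} (hW : ContDiff ℝ 3 W) {i : ℕ} (hi : i < 3) (x : ℝ) :
    HasDerivAt (iteratedDeriv i W) (iteratedDeriv (i + 1) W x) x := by
  rw [iteratedDeriv_succ]
  exact (hW.differentiable_iteratedDeriv i (by exact_mod_cast hi) x).hasDerivAt

lemma continuous_iteratedDeriv' {W : ℝ → ℝ} (hW : ContDiff ℝ 3 W) {i : ℕ} (hi : i ≤ 3) :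
    Continuous (iteratedDeriv i W) := hW.continuous_iteratedDeriv i (by exact_mod_cast hi)

/-- Summability matters because a divergent `tsum` is `0`, and then the term `l = j` would not bound
the sum from below. -/
lemma summable_inv_sq (j : ℕ) :
    Summable fun l : ℕ+ => ((2 * |(l : ℝ) - j| - 1) ^ 2)⁻¹ := by
  have h1 : Summable fun n : ℕ => ((2 * (n : ℝ) - 1) ^ 2)⁻¹ := by
    rw [← summable_nat_add_iff 1]
    have h := (summable_nat_add_iff (f := fun n : ℕ => ((n : ℝ) ^ 2)⁻¹) 1).2
      (Real.summable_nat_pow_inv.2 (by norm_num))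
    refine h.of_nonneg_of_le (fun n => by positivity) fun n => ?_
    have : (0 : ℝ) ≤ n := n.cast_nonneg
    refine inv_anti₀ (by positivity) ?_
    push_cast
    gcongr
    linarith
  have h2 : Summable fun n : ℤ => ((2 * |(n : ℝ)| - 1) ^ 2)⁻¹ := by
    refine Summable.of_nat_of_neg ?_ ?_ <;> simpa using h1
  have hinj : Function.Injective fun l : ℕ+ => ((l : ℕ) : ℤ) - j := fun a b h => by
    have : ((a : ℕ) : ℤ) = (b : ℕ) := sub_left_injective h
    exact PNat.eq (by exact_mod_cast this)
  refine (h2.comp_injective hinj).congr fun l => ?_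
  simp

/-- In `c₃` the term `l = j` of the first sum equals `1`, and the second root is at least `√4`. -/
lemma two_mul_le_c₃ (W : ℝ → ℝ) {j : ℕ} (hj : 1 ≤ j) :
    2 * linftyNorm W * linftyNorm (iteratedDeriv 2 W) ≤ c₃ W j := by
  have h1 : 1 ≤ √(∑' l : ℕ+, ((2 * |(l : ℝ) - j| - 1) ^ 2)⁻¹) := by
    rw [Real.one_le_sqrt]
    refine le_trans ?_ ((summable_inv_sq j).le_tsum (⟨j, hj⟩ : ℕ+) fun l _ => by positivity)
    simp
  have h2 : 2 ≤
      √(∑' l : {l : ℕ+ // (l : ℕ) ≠ j}, ((2 * |((l : ℕ+) : ℝ) - j| - 3 / 2) ^ 2)⁻¹ + 4) := by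
    rw [Real.le_sqrt' (by norm_num)]
    have : 0 ≤ ∑' l : {l : ℕ+ // (l : ℕ) ≠ j}, ((2 * |((l : ℕ+) : ℝ) - j| - 3 / 2) ^ 2)⁻¹ :=
      tsum_nonneg fun l => by positivity
    linarith
  have h3 := linftyNorm_nonneg W
  have h4 := linftyNorm_nonneg (iteratedDeriv 2 W)
  rw [c₃]
  calc 2 * linftyNorm W * linftyNorm (iteratedDeriv 2 W)
      = linftyNorm W * linftyNorm (iteratedDeriv 2 W) * 1 * 2 := by ring
    _ ≤ _ := by gcongr

lemma c₄_nonneg (W : ℝ → ℝ) (j : ℕ) : 0 ≤ c₄ W j :=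
  mul_nonneg (linftyNorm_nonneg _) (integral_nonneg fun y => by positivity)

lemma c₅_nonneg (W : ℝ → ℝ) (j : ℕ) : 0 ≤ c₅ W j := by
  have := linftyNorm_nonneg W
  have := linftyNorm_nonneg (iteratedDeriv 2 W)
  unfold c₅ c₃
  positivity

lemma integrable_abs_mul_osc_sq {s : ℝ} (hs : 0 < s) (m : ℕ) :
    Integrable fun x => |x| * osc s m x ^ 2 := by
  refine ((memLp_id_mul_osc hs m).integrable_mul (memLp_osc hs m)).abs.congr
    (Eventually.of_forall fun x => ?_)
  simp only [Pi.mul_apply, abs_mul, ← sq_abs (osc s m x)]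
  ring

lemma integral_abs_mul_osc_sq {s : ℝ} (hs : 0 < s) (m : ℕ) :
    ∫ x, |x| * osc s m x ^ 2 = (∫ y, |y| * hermiteFun (m + 1) y ^ 2) / s := by
  rw [← integral_comp_mul_mul hs (fun y => |y| * hermiteFun (m + 1) y ^ 2), mul_div_right_comm,
    div_self hs.ne', one_mul]
  congr 1
  funext x
  rw [osc, mul_pow, Real.sq_sqrt hs.le, abs_mul, abs_of_pos hs]
  ring

/-- The square of `osc s m` is a probability density, `|f (x + t) - f t| ≤ C' |x|`, and the first
absolute moment scales like `1 / s`. -/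
lemma abs_inner_mulOp_sub_le {s : ℝ} (hs : 0 < s) (m : ℕ) {f f' : ℝ → ℝ} (hfc : Continuous f)
    (hf : ∀ x, HasDerivAt f (f' x) x) {C C' : ℝ} (hC : ∀ x, |f x| ≤ C) (hC' : ∀ x, |f' x| ≤ C')
    (t : ℝ) :
    |(⟪oscVec hs m, mulOp (translate f hfc hC t) (oscVec hs m)⟫_ℂ).re - f t| ≤
      C' * ((∫ y, |y| * hermiteFun (m + 1) y ^ 2) / s) := by
  have h1 : mulOp (translate f hfc hC t) (oscVec hs m) =ᵐ[volume]
      fun x => ((f (x + t) * osc s m x : ℝ) : ℂ) := by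
    filter_upwards [coeFn_mulOp (translate f hfc hC t) (oscVec hs m), coeFn_oscVec hs m]
      with x e1 e2
    rw [e1, e2, translate_apply]; push_cast; rfl
  have hsq : Integrable fun x => osc s m x * osc s m x :=
    (memLp_osc hs m).integrable_mul (memLp_osc hs m)
  have hint : Integrable fun x => f (x + t) * (osc s m x * osc s m x) :=
    hsq.bdd_mul (c := C) (by fun_prop) (Eventually.of_forall fun x => hC (x + t))
  have h2 : (⟪oscVec hs m, mulOp (translate f hfc hC t) (oscVec hs m)⟫_ℂ).re =
      ∫ x, f (x + t) * (osc s m x * osc s m x) := by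
    rw [inner_oscVec hs m h1]
    have : ∀ x, (osc s m x : ℂ) * ((f (x + t) * osc s m x : ℝ) : ℂ) =
        ((f (x + t) * (osc s m x * osc s m x) : ℝ) : ℂ) := fun x => by push_cast; ring
    simp only [this]
    rw [integral_complex_ofReal, Complex.ofReal_re]
  have h3 : f t = ∫ x, f t * (osc s m x * osc s m x) := by
    rw [integral_const_mul, integral_osc_sq hs, mul_one]
  rw [h2, h3, ← integral_sub hint (hsq.const_mul _), ← integral_abs_mul_osc_sq hs,
    ← integral_const_mul]
  refine (abs_integral_le_integral_abs).trans (integral_mono_of_nonneg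
    (Eventually.of_forall fun x => abs_nonneg _) ((integrable_abs_mul_osc_sq hs m).const_mul C')
    (Eventually.of_forall fun x => ?_))
  have h4 := abs_sub_le_of_hasDerivAt hf hC' t (x + t)
  rw [add_sub_cancel_right] at h4
  simp only
  rw [← sub_mul, ← sq, abs_mul, abs_of_nonneg (sq_nonneg (osc s m x)), ← mul_assoc]
  gcongr

/-- The `(m + 1)`-th eigenvalue as a function of `k / b`, with the bound of its second
derivative. -/
lemma exists_family {W : ℝ → ℝ} (hW : ContDiff ℝ 3 W)
    (hbdd : ∀ i ≤ 3, MemLp (iteratedDeriv i W) ∞ (volume : Measure ℝ)) {b : ℝ}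
    (hb : 2 * linftyNorm W < b) (m : ℕ) :
    ∃ F : ℝ → ℝ, ContDiff ℝ 2 F ∧
      (∀ k μ, IsNthEigenvalue (m + 1) b W k μ ↔ μ = (2 * m + 1) * b + F (k / b)) ∧
      ∀ t, |iteratedDeriv 2 F t - iteratedDeriv 2 W t| ≤
        2 * linftyNorm W * linftyNorm (iteratedDeriv 2 W) / b +
        2 * linftyNorm (iteratedDeriv 1 W) ^ 2 / b +
        linftyNorm (iteratedDeriv 3 W) * ((∫ y, |y| * hermiteFun (m + 1) y ^ 2) / √b) := by
  have hw := linftyNorm_nonneg W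
  have hb0 : 0 < b := by linarith
  have hs := Real.sqrt_pos.2 hb0
  have hc : ∀ i ≤ 3, Continuous (iteratedDeriv i W) := fun i hi => continuous_iteratedDeriv' hW hi
  have hle : ∀ i ≤ 3, ∀ x, |iteratedDeriv i W x| ≤ linftyNorm (iteratedDeriv i W) :=
    fun i hi => abs_le_linftyNorm (hc i hi) (hbdd i hi)
  have hd : ∀ i < 3, ∀ x, HasDerivAt (iteratedDeriv i W) (iteratedDeriv (i + 1) W x) x :=
    fun i hi => hasDerivAt_iteratedDeriv hW hi
  have hc0 := hc 0 (by norm_num)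
  have hle0 := hle 0 (by norm_num)
  have hd0 := hd 0 (by norm_num)
  simp only [iteratedDeriv_zero] at hc0 hle0 hd0
  let T : ℝ → ℝ →ᵇ ℝ := translate W hc0 hle0
  let T₁ : ℝ → ℝ →ᵇ ℝ := translate _ (hc 1 (by norm_num)) (hle 1 (by norm_num))
  let T₂ : ℝ → ℝ →ᵇ ℝ := translate _ (hc 2 (by norm_num)) (hle 2 (by norm_num))
  have hB : ∀ t, IsSymmBdd (mulOp (T t)) (linftyNorm W) := fun t =>
    isSymmBdd_mulOp hw fun x => hle0 (x + t)
  -- All levels `l` are needed to count the eigenvalues below a given one; only the family at `m` is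
  -- differentiated.
  choose R hR hR' using fun l => exists_reducedResolvent (oscBasis hs) hb0 l
  choose ε hε hε' using fun l t => exists_shift (hR l) hb hw (hB t)
  have hspec := fun l t => corrector_spec (hR l) hb ((hB t).shift (hε l t))
  have hfam : IsPerturbedFamily (R m) (oscBasis hs m) b (linftyNorm W)
      (linftyNorm (iteratedDeriv 1 W)) (linftyNorm (iteratedDeriv 2 W))
      (fun t => mulOp (T t)) (fun t => mulOp (T₁ t)) (fun t => mulOp (T₂ t)) (ε m) :=
    { reduced := hR m
      gap := hb
      symm := hB
      symm' := fun t => isSymmBdd_mulOp (linftyNorm_nonneg _) fun x => hle 1 (by norm_num) (x + t)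
      symm'' := fun t => isSymmBdd_mulOp (linftyNorm_nonneg _) fun x => hle 2 (by norm_num) (x + t)
      hasDeriv := fun t => mulOpL.hasFDerivAt.comp_hasDerivAt t
        (hasDerivAt_translate _ _ hd0 (hd 1 (by norm_num)) _ _ (hle 2 (by norm_num)) t)
      hasDeriv' := fun t => mulOpL.hasFDerivAt.comp_hasDerivAt t
        (hasDerivAt_translate _ _ (hd 1 (by norm_num)) (hd 2 (by norm_num)) _ _
          (hle 3 (by norm_num)) t)
      cont'' := mulOpL.continuous.comp
        (continuous_translate _ (hd 2 (by norm_num)) _ (hle 3 (by norm_num)))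
      abs_le := hε m
      inner_eq := hε' m }
  refine ⟨ε m, hfam.contDiff_shift, fun k μ => ?_, fun t => ?_⟩
  · have heig : eigenvalues b W k = diagEigenvalues (oscBasis hs) b (mulOp (T (k / b))) := by
      rw [eigenvalues_translate hb0.ne']
      exact eigenvalues_eq_diagEigenvalues hb0 (T (k / b))
    rw [IsNthEigenvalue, heig]
    refine nth_of_clusters (F := fun l => (2 * l + 1) * b + ε l (k / b)) hb
      (fun μ hμ => exists_abs_sub_le (oscBasis hs) hw (hB _) hμ)
      (fun l => mem_diagEigenvalues (hR l) (hR' l) (hspec l _) (hε' l _))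
      (fun l => by rw [add_sub_cancel_left]; exact hε l _)
      (fun l μ hμ hl => shift_unique_of_mem (hR l) (hR' l) hb (hB _) hμ hl (hε l _) (hspec l _)
        (hε' l _)) m μ
  · have h1 := hfam.abs_eigSlopeDeriv_sub_le (linftyNorm_nonneg _) t
    have h2 := abs_inner_mulOp_sub_le hs m (hc 2 (by norm_num)) (hd 2 (by norm_num))
      (hle 2 (by norm_num)) (hle 3 (by norm_num)) t
    rw [oscBasis_apply] at h1
    rw [hfam.iteratedDeriv_shift, oscBasis_apply]
    exact (abs_sub_le _ _ _).trans (add_le_add h1 h2)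

lemma iteratedDeriv_two_comp_div {F : ℝ → ℝ} (hF : ContDiff ℝ 2 F) (b c k : ℝ) :
    iteratedDeriv 2 (fun k => c + F (k / b)) k = iteratedDeriv 2 F (k / b) / b ^ 2 := by
  have h1 : ∀ k, HasDerivAt (fun k => c + F (k / b)) (deriv F (k / b) * (1 / b)) k := fun k =>
    (((hF.differentiable (by norm_num)) (k / b)).hasDerivAt.comp k
      ((hasDerivAt_id k).div_const b)).const_add c
  have hF1 : ContDiff ℝ 1 (deriv F) := by
    rw [show (2 : WithTop ℕ∞) = 1 + 1 by norm_num, contDiff_succ_iff_deriv] at hF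
    exact hF.2.2
  have h2 : ∀ k, HasDerivAt (fun k => deriv F (k / b) * (1 / b))
      (deriv (deriv F) (k / b) * (1 / b) * (1 / b)) k := fun k =>
    (((hF1.differentiable (by norm_num)) (k / b)).hasDerivAt.comp k
      ((hasDerivAt_id k).div_const b)).mul_const _
  rw [iteratedDeriv_succ, iteratedDeriv_one, funext fun k => (h1 k).deriv, (h2 k).deriv,
    iteratedDeriv_succ, iteratedDeriv_one]
  ring

lemma rpow_five_halves {b : ℝ} (hb : 0 < b) : b ^ (5 / 2 : ℝ) = b ^ 2 * √b := by
  rw [show (5 / 2 : ℝ) = (2 : ℕ) + 1 / 2 by norm_num, Real.rpow_add hb, Real.rpow_natCast,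
    Real.sqrt_eq_rpow]

lemma exists_forall_lt {p q d : ℝ} (hp : 0 ≤ p) (hq : 0 ≤ q) (hd : 0 < d) (M : ℝ) :
    ∃ b₁ : ℝ, 0 < b₁ ∧ ∀ b, b₁ < b → M < b ∧ 0 < b ∧
      p / b ^ 3 + q / b ^ (5 / 2 : ℝ) < d / b ^ 2 := by
  -- For `b ≥ 1`, `p / b + q / √b ≤ (p + q) / √b`, which is below `d` once `√b > (p + q) / d`.
  refine ⟨max (max M 1) (((p + q) / d) ^ 2), lt_max_of_lt_left (lt_max_of_lt_right one_pos), ?_⟩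
  intro b hb
  have hb1 : 1 < b := (le_max_right M 1).trans_lt ((le_max_left _ _).trans_lt hb)
  have hb0 : 0 < b := by linarith
  have hs : (p + q) / d < √b := Real.lt_sqrt_of_sq_lt ((le_max_right _ _).trans_lt hb)
  have hs1 : 1 ≤ √b := Real.one_le_sqrt.2 hb1.le
  refine ⟨(le_max_left M 1).trans_lt ((le_max_left _ _).trans_lt hb), hb0, ?_⟩
  rw [div_lt_iff₀ hd] at hs
  have hsb : √b * √b = b := Real.mul_self_sqrt hb0.le
  have hsle : √b ≤ b := by nlinarith
  rw [rpow_five_halves hb0]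
  have hs0 : 0 < √b := by positivity
  calc p / b ^ 3 + q / (b ^ 2 * √b) = (p / b + q / √b) / b ^ 2 := by field_simp
    _ ≤ (p / √b + q / √b) / b ^ 2 := by gcongr
    _ = (p + q) / √b / b ^ 2 := by rw [add_div p q]
    _ < d / b ^ 2 := by
      gcongr
      rw [div_lt_iff₀ hs0]; linarith

end Main

end EdgePotential

end

theorem mainTheorem7 (W : ℝ → ℝ) (hW : ContDiff ℝ 3 W)
    (hbdd : ∀ i ≤ 3, MemLp (iteratedDeriv i W) ∞ (volume : Measure ℝ))
    (j : ℕ) (hj : 1 ≤ j) :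
    (∀ b : ℝ, 2 * EdgePotential.linftyNorm W < b →
      (∀ k : ℝ, EdgePotential.IsNthEigenvalue j b W k (EdgePotential.bandE j b W k)) ∧
      ContDiff ℝ 2 (EdgePotential.bandE j b W) ∧
      ∀ k : ℝ,
        |iteratedDeriv 2 (EdgePotential.bandE j b W) k - iteratedDeriv 2 W (k / b) / b ^ 2| ≤
          EdgePotential.c₅ W j / b ^ 3 + EdgePotential.c₄ W j / b ^ (5 / 2 : ℝ)) ∧
    ∀ x₀ : ℝ,
      (0 < iteratedDeriv 2 W x₀ → ∃ b₁ : ℝ, 0 < b₁ ∧ ∀ b : ℝ, b₁ < b →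
        0 < iteratedDeriv 2 (EdgePotential.bandE j b W) (b * x₀)) ∧
      (iteratedDeriv 2 W x₀ < 0 → ∃ b₁ : ℝ, 0 < b₁ ∧ ∀ b : ℝ, b₁ < b →
        iteratedDeriv 2 (EdgePotential.bandE j b W) (b * x₀) < 0) := by
  have main : ∀ b : ℝ, 2 * EdgePotential.linftyNorm W < b →
      (∀ k : ℝ, EdgePotential.IsNthEigenvalue j b W k (EdgePotential.bandE j b W k)) ∧
      ContDiff ℝ 2 (EdgePotential.bandE j b W) ∧
      ∀ k : ℝ,
        |iteratedDeriv 2 (EdgePotential.bandE j b W) k - iteratedDeriv 2 W (k / b) / b ^ 2| ≤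
          EdgePotential.c₅ W j / b ^ 3 + EdgePotential.c₄ W j / b ^ (5 / 2 : ℝ) := by
    intro b hb
    -- The levels are numbered from zero: `(2m + 1) b = (2j - 1) b`.
    obtain ⟨m, rfl⟩ : ∃ m, j = m + 1 := ⟨j - 1, by omega⟩
    have hb0 : 0 < b := by linarith [EdgePotential.linftyNorm_nonneg W]
    obtain ⟨F, hF, hF1, hF2⟩ := EdgePotential.exists_family hW hbdd hb m
    have hE : EdgePotential.bandE (m + 1) b W = fun k => (2 * m + 1) * b + F (k / b) := by
      funext k
      simp only [EdgePotential.bandE, hF1, Set.ofPred_eq_eq_singleton, csInf_singleton]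
    refine ⟨fun k => (hF1 k _).2 (congrFun hE k), ?_, fun k => ?_⟩
    · rw [hE]
      exact contDiff_const.add (hF.comp (contDiff_id.div_const b))
    · rw [hE, EdgePotential.iteratedDeriv_two_comp_div hF, ← sub_div, abs_div,
        abs_of_pos (by positivity : 0 < b ^ 2), EdgePotential.rpow_five_halves hb0]
      have h1 := hF2 (k / b)
      have h2 := EdgePotential.two_mul_le_c₃ W hj
      have hs0 : 0 < √b := Real.sqrt_pos.2 hb0
      rw [EdgePotential.c₅, EdgePotential.c₄]
      generalize EdgePotential.c₃ W (m + 1) = c at h2 ⊢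
      calc _ ≤ (c / b + 2 * EdgePotential.linftyNorm (iteratedDeriv 1 W) ^ 2 / b +
            EdgePotential.linftyNorm (iteratedDeriv 3 W) *
              ((∫ y, |y| * EdgePotential.hermiteFun (m + 1) y ^ 2) / √b)) / b ^ 2 := by
            gcongr
            exact h1.trans (by gcongr)
        _ = _ := by field_simp
  refine ⟨main, fun x₀ => ?_⟩
  have hp := EdgePotential.c₅_nonneg W j
  have hq := EdgePotential.c₄_nonneg W j
  constructor
  · intro hd
    obtain ⟨b₁, hb₁, h⟩ := EdgePotential.exists_forall_lt hp hq hd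
      (2 * EdgePotential.linftyNorm W)
    refine ⟨b₁, hb₁, fun b hb => ?_⟩
    obtain ⟨h1, h2, h3⟩ := h b hb
    have h4 := (main b h1).2.2 (b * x₀)
    rw [mul_div_cancel_left₀ _ h2.ne'] at h4
    linarith [(abs_le.1 h4).1]
  · intro hd
    obtain ⟨b₁, hb₁, h⟩ := EdgePotential.exists_forall_lt hp hq (neg_pos.2 hd)
      (2 * EdgePotential.linftyNorm W)
    refine ⟨b₁, hb₁, fun b hb => ?_⟩
    obtain ⟨h1, h2, h3⟩ := h b hb
    have h4 := (main b h1).2.2 (b * x₀)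
    rw [mul_div_cancel_left₀ _ h2.ne'] at h4
    rw [neg_div] at h3
    linarith [(abs_le.1 h4).2]
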